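/- **Theorem (Stability of the safe monotone flow relative to $\mathcal C$).** Let $F:\mathbb R^n\to\mathbb R^n$ be continuously differentiable, let $g_1,\dots,g_m:\mathbb R^n\to\mathbb R$ be convex and twice continuously differentiable, let $h(x)=Hx-c$ with $H\in\mathbb R^{k\times n}$, $c\in\mathbb R^k$, and let $$\mathcal C=\{x\in\mathbb R^n : g(x)\le 0,\ h(x)=0\}.$$ Assume that the Mangasarian–Fromovitz constraint qualification holds at every $x\in\mathcal C$: the vectors $\nabla h_1(x),\dots,\nabla h_k(x)$ are linearly independent and there is $\xi\in\mathbb R^n$ with $\nabla g_i(x)^\top\xi<0$ whenever $g_i(x)=0$ and $\nabla h_j(x)^\top\xi=0$ for all $j$. Let $\alpha>0$ and let $x^*\in\mathrm{SOL}(F,\mathcal C)$, i.e. $x^*\in\mathcal C$ and $(x-x^*)^\top F(x^*)\ge 0$ for all $x\in\mathcal C$. Put $T^{(\alpha)}_{\mathcal C}(x)=\{\xi\in\mathbb R^n : \nabla g_i(x)^\top\xi\le-\alpha g_i(x)\ \forall i,\ \nabla h_j(x)^\top\xi=-\alpha h_j(x)\ \forall j\}$ and $\mathcal F(x,u,v)=-F(x)-\sum_i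 u_i\nabla g_i(x)-\sum_j v_j\nabla h_j(x)$. The safe monotone flow with parameter $\alpha$ is $\dot x=\mathcal G_\alpha(x)$, where $\mathcal G_\alpha(x)=\mathcal F(x,u,v)$ for any minimizer $(u,v)$ of $\tfrac12\big\|\sum_i u_i\nabla g_i(x)+\sum_j v_j\nabla h_j(x)\big\|^2$ over all $(u,v)\in\mathbb R^m_{\ge0}\times\mathbb R^k$ with $\mathcal F(x,u,v)\in T^{(\alpha)}_{\mathcal C}(x)$. Let $$V(x)=\tfrac12\|x-x^*\|^2-\tfrac1{\alpha^2}W(x),\qquad W(x)=\inf_{\xi\in T^{(\alpha)}_{\mathcal C}(x)}\Big\{\xi^\top F(x)+\tfrac12\|\xi\|^2\Big\}.$$ 1. If $F$ is monotone, i.e. $(x-y)^\top(F(x)-F(y))\ge0$ for all $x,y$, then $x^*$ is globally Lyapunov stable relative to $\mathcal C$ for the safe monotone flow: from every $x_0\in\mathcal C$ there starts a solution on $[0,\infty)$; every solution starting in $\mathcal C$ stays in $\mathcal C$; for every $\varepsilon>0$ there is $\delta>0$ such that every solution with $x(0)\in\mathcal C$, $\|x(0)-x^*\|<\delta$ satisfies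 $\|x(t)-x^*\|<\varepsilon$ for all $t\ge 0$ in its interval of definition; and for every $R$ there is $M$ such that every solution with $x(0)\in\mathcal C$, $\|x(0)-x^*\|\le R$ satisfies $\|x(t)-x^*\|\le M$ for all such $t$. Moreover $V$ is a Lyapunov function on $\mathcal C$: it is continuous on $\mathcal C$, $V(x^*)=0$, $V(x)>0$ for $x\in\mathcal C\setminus\{x^*\}$, and for every solution with $x(0)\in\mathcal C$ $$\limsup_{t\to0^+}\frac{V(x(t))-V(x(0))}{t}\le0.$$ 2. If $F$ is $\mu$-strongly monotone with $\mu>0$, i.e. $(x-y)^\top(F(x)-F(y))\ge\mu\|x-y\|^2$ for all $x,y$, then $x^*$ is globally asymptotically stable relative to $\mathcal C$: it is globally Lyapunov stable relative to $\mathcal C$ in the sense of 1, and every solution on $[0,\infty)$ starting in $\mathcal C$ converges to $x^*$. Moreover $V$ is continuous on $\mathcal C$, $V(x^*)=0$, $V>0$ on $\mathcal C\setminus\{x^*\}$, and for every solution with $x(0)\in\mathcal C$ $$\limsup_{t\to0^+}\frac{V(x(t))-V(x(0))}{t}\le-\mu\|x(0)-x^*\|^2.$$ -/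

import Mathlib

open scoped Gradient RealInnerProductSpace

noncomputable section

namespace SafeMonotoneFlow

/-- `ℝⁿ` with the Euclidean norm. -/
abbrev E (n : ℕ) : Type := EuclideanSpace ℝ (Fin n)

variable {n m k : ℕ}

/-! ### Variational inequalities -/

/-- `F` is monotone. -/
def IsMonotoneMap (F : E n → E n) : Prop :=
  ∀ x y : E n, 0 ≤ ⟪x - y, F x - F y⟫

/-- The defining inequality of `μ`-strong monotonicity (used with `0 < μ`). -/
def IsStronglyMonotoneMap (μ : ℝ) (F : E n → E n) : Prop :=
  ∀ x y : E n, μ * ‖x - y‖ ^ 2 ≤ ⟪x - y, F x - F y⟫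

/-- `SOL(F, C)`: the solution set of the variational inequality `VI(F, C)`. -/
def viSol (F : E n → E n) (C : Set (E n)) : Set (E n) :=
  {x | x ∈ C ∧ ∀ y ∈ C, 0 ≤ ⟪y - x, F x⟫}

/-- The components of the affine map `h(x) = H x - c`. -/
def affineMap (H : Matrix (Fin k) (Fin n) ℝ) (c : Fin k → ℝ) (j : Fin k) (x : E n) : ℝ :=
  H.mulVec x.ofLp j - c j

/-- `C = {x | g(x) ≤ 0, h(x) = 0}`. -/
def constraintSet (g : Fin m → E n → ℝ) (h : Fin k → E n → ℝ) : Set (E n) :=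
  {x | (∀ i, g i x ≤ 0) ∧ ∀ j, h j x = 0}

/-- The Mangasarian-Fromovitz constraint qualification at `x`. -/
def MFCQAt (g : Fin m → E n → ℝ) (h : Fin k → E n → ℝ) (x : E n) : Prop :=
  LinearIndependent ℝ (fun j => ∇ (h j) x) ∧
    ∃ ξ : E n, (∀ i, g i x = 0 → ⟪∇ (g i) x, ξ⟫ < 0) ∧ ∀ j, ⟪∇ (h j) x, ξ⟫ = 0

/-! ### The safe monotone flow -/

/-- `∑ uᵢ ∇gᵢ(x) + ∑ vⱼ ∇hⱼ(x)`. -/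
def constraintForce (g : Fin m → E n → ℝ) (h : Fin k → E n → ℝ) (x : E n)
    (p : (Fin m → ℝ) × (Fin k → ℝ)) : E n :=
  ∑ i, p.1 i • ∇ (g i) x + ∑ j, p.2 j • ∇ (h j) x

/-- The control-affine system `𝓕(x, u, v) = -F(x) - ∑ uᵢ ∇gᵢ(x) - ∑ vⱼ ∇hⱼ(x)`. -/
def controlSystem (F : E n → E n) (g : Fin m → E n → ℝ) (h : Fin k → E n → ℝ) (x : E n)
    (p : (Fin m → ℝ) × (Fin k → ℝ)) : E n :=
  -F x - constraintForce g h x p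

/-- The `α`-restricted tangent set at `x`. -/
def restrictedTangentSet (α : ℝ) (g : Fin m → E n → ℝ) (h : Fin k → E n → ℝ) (x : E n) :
    Set (E n) :=
  {ξ | (∀ i, ⟪∇ (g i) x, ξ⟫ ≤ -α * g i x) ∧ ∀ j, ⟪∇ (h j) x, ξ⟫ = -α * h j x}

/-- The admissible controls `(u, v)`, `u ≥ 0`, satisfying the control barrier conditions
`∇gᵢ(x)ᵀ 𝓕(x,u,v) ≤ -α gᵢ(x)` and `∇hⱼ(x)ᵀ 𝓕(x,u,v) = -α hⱼ(x)`. -/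
def Kcbf (α : ℝ) (F : E n → E n) (g : Fin m → E n → ℝ) (h : Fin k → E n → ℝ) (x : E n) :
    Set ((Fin m → ℝ) × (Fin k → ℝ)) :=
  {p | (∀ i, 0 ≤ p.1 i) ∧ controlSystem F g h x p ∈ restrictedTangentSet α g h x}

/-- The cost `J(x, u, v) = ½ ‖∑ uᵢ ∇gᵢ(x) + ∑ vⱼ ∇hⱼ(x)‖²`. -/
def controlCost (g : Fin m → E n → ℝ) (h : Fin k → E n → ℝ) (x : E n)
    (p : (Fin m → ℝ) × (Fin k → ℝ)) : ℝ :=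
  1 / 2 * ‖constraintForce g h x p‖ ^ 2

/-- The right-hand side `𝓖_α` of the safe monotone flow: the closed-loop velocities
`𝓕(x, u, v)` with `(u, v)` a minimizer of `J(x, ·)` over `Kcbf`. It is kept set-valued because the
minimizer need not be unique, and need not exist far from the constraint set. -/
def safeMonotoneFlow (α : ℝ) (F : E n → E n) (g : Fin m → E n → ℝ) (h : Fin k → E n → ℝ)
    (x : E n) : Set (E n) :=
  {ξ | ∃ p ∈ Kcbf α F g h x,
    (∀ q ∈ Kcbf α F g h x, controlCost g h x p ≤ controlCost g h x q) ∧
      ξ = controlSystem F g h x p}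

/-! ### Solutions and stability relative to a set -/

/-- `x` solves `x'(t) ∈ 𝓖(x(t))` on the interval `I` (one-sided derivatives at end points). -/
def IsSolutionOn (𝓖 : E n → Set (E n)) (x : ℝ → E n) (I : Set ℝ) : Prop :=
  ∀ t ∈ I, ∃ ξ ∈ 𝓖 (x t), HasDerivWithinAt x ξ I t

/-- `xs` is globally Lyapunov stable relative to `C`: from every point of `C` there starts a
solution on `[0, ∞)`, solutions starting in `C` remain in `C`, those starting close to `xs` remain
close to `xs`, and those starting in a bounded part of `C` are uniformly bounded. The last three
properties concern all solutions, including those on a finite interval. -/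
structure GloballyLyapunovStableRel (𝓖 : E n → Set (E n)) (C : Set (E n)) (xs : E n) :
    Prop where
  exists_solution : ∀ x₀ ∈ C, ∃ x : ℝ → E n, x 0 = x₀ ∧ IsSolutionOn 𝓖 x (Set.Ici 0)
  invariant : ∀ (T : ℝ) (x : ℝ → E n), IsSolutionOn 𝓖 x (Set.Icc 0 T) → x 0 ∈ C →
    ∀ t ∈ Set.Icc 0 T, x t ∈ C
  stable : ∀ ε > 0, ∃ δ > 0, ∀ (T : ℝ) (x : ℝ → E n), IsSolutionOn 𝓖 x (Set.Icc 0 T) →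
    x 0 ∈ C → ‖x 0 - xs‖ < δ → ∀ t ∈ Set.Icc 0 T, ‖x t - xs‖ < ε
  bounded : ∀ R : ℝ, ∃ M : ℝ, ∀ (T : ℝ) (x : ℝ → E n), IsSolutionOn 𝓖 x (Set.Icc 0 T) →
    x 0 ∈ C → ‖x 0 - xs‖ ≤ R → ∀ t ∈ Set.Icc 0 T, ‖x t - xs‖ ≤ M

/-- `xs` is globally asymptotically stable relative to `C`: globally Lyapunov stable, and every
solution on `[0, ∞)` starting in `C` converges to `xs`. -/
structure GloballyAsymptoticallyStableRel (𝓖 : E n → Set (E n)) (C : Set (E n)) (xs : E n) :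
    Prop extends GloballyLyapunovStableRel 𝓖 C xs where
  attractive : ∀ x : ℝ → E n, IsSolutionOn 𝓖 x (Set.Ici 0) → x 0 ∈ C →
    Filter.Tendsto x Filter.atTop (nhds xs)

/-! ### The Lyapunov function -/

/-- The upper-right Dini derivative of `φ` at `0`, with values in `[-∞, ∞]`. -/
def upperRightDini (φ : ℝ → ℝ) : EReal :=
  Filter.limsup (fun s : ℝ => (((φ s - φ 0) / s : ℝ) : EReal)) (nhdsWithin 0 (Set.Ioi 0))

/-- `V` is a Lyapunov function on `C` for the point `xs` whose upper-right Dini derivative along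
the flow is at most `-w` at every point of `C`. -/
structure IsLyapunovFunctionOn (𝓖 : E n → Set (E n)) (C : Set (E n)) (xs : E n)
    (V w : E n → ℝ) : Prop where
  continuousOn : ContinuousOn V C
  eq_zero : V xs = 0
  pos : ∀ x ∈ C, x ≠ xs → 0 < V x
  dini_le : ∀ T > 0, ∀ x : ℝ → E n, IsSolutionOn 𝓖 x (Set.Icc 0 T) → x 0 ∈ C →
    upperRightDini (fun t => V (x t)) ≤ ((-w (x 0) : ℝ) : EReal)

/-- The optimal value `W(x) = inf {ξᵀ F(x) + ½ ‖ξ‖² | ξ ∈ T^(α)(x)}`. On the constraint set the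
infimum is over a nonempty set (it contains `0`) and is bounded below by `-½ ‖F(x)‖²`. -/
def optimalValue (α : ℝ) (F : E n → E n) (g : Fin m → E n → ℝ) (h : Fin k → E n → ℝ)
    (x : E n) : ℝ :=
  sInf ((fun ξ : E n => ⟪ξ, F x⟫ + 1 / 2 * ‖ξ‖ ^ 2) '' restrictedTangentSet α g h x)

/-- `V(x) = ½ ‖x - xs‖² - W(x) / α²`. -/
def lyapunovCandidate (α : ℝ) (F : E n → E n) (g : Fin m → E n → ℝ) (h : Fin k → E n → ℝ)
    (xs x : E n) : ℝ :=
  1 / 2 * ‖x - xs‖ ^ 2 - 1 / α ^ 2 * optimalValue α F g h x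

end SafeMonotoneFlow

end

noncomputable section

namespace SafeMonotoneFlow

open Set Filter Topology

/-!
`W` is the value of a quadratic program with strictly feasible constraints, so it equals its
Lagrangian dual, which for multipliers `p = (u, v)` reads
`α (∑ uᵢ gᵢ(x) + ∑ vⱼ hⱼ(x)) - ½ ‖𝓕(x, p)‖²`. The dual value bounds `W` from below for every `p`
with `u ≥ 0`, with equality at the optimal `p`, and then `𝓕(x, p)` is the closed-loop velocity, the
projection of `-F(x)` onto the restricted tangent set. Freezing the multipliers that are optimal at
time `t` hence yields a differentiable function that touches `V(x(s))` from above at `s = t`. Its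
derivative is `⟪x - x*, 𝓕(x, p)⟫ + ∑ uᵢ gᵢ(x) + ∑ vⱼ hⱼ(x)` plus `α⁻² ⟪ξ, D𝓕(·, p)(x) ξ⟫` with
`ξ = 𝓕(x, p)`. The second term is nonpositive because `-𝓕(·, p)` is monotone; the first one is at
most `-μ ‖x - x*‖²` by monotonicity of `F`, convexity of the constraints and the variational
inequality. On the constraint set `W ≤ 0`, so `V` dominates `½ ‖x - x*‖²`, and stability follows.

The velocity is continuous on the constraint set but in general not Lipschitz. Solutions are
obtained from Peano's theorem for the field composed with the projection onto the constraint set and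
truncated far away; they cannot leave the constraint set since the velocity points into it, and the
decrease of `V` keeps them where nothing has been truncated.
-/

/-! ### Differential inequalities -/

section DifferentialInequalities

variable {φ : ℝ → ℝ} {a b c t : ℝ} {I : Set ℝ}

/-- `φ` is touched from above at `t`, among the points of `I`, by a function with derivative at most
`c`. This one-sided substitute for a derivative of `φ` is what an optimal value function has. -/
def HasUpperSupport (φ : ℝ → ℝ) (I : Set ℝ) (t c : ℝ) : Prop :=
  ∃ (ψ : ℝ → ℝ) (d : ℝ), (∀ s ∈ I, φ s ≤ ψ s) ∧ φ t = ψ t ∧ HasDerivWithinAt ψ d I t ∧ d ≤ c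

theorem HasUpperSupport.mono {c' : ℝ} (hφ : HasUpperSupport φ I t c) (hc : c ≤ c') :
    HasUpperSupport φ I t c' :=
  let ⟨ψ, d, hle, heq, hψ, hd⟩ := hφ
  ⟨ψ, d, hle, heq, hψ, hd.trans hc⟩

theorem HasUpperSupport.eventually_slope_lt {r : ℝ} (hφ : HasUpperSupport φ I t c)
    (hI : I ∈ 𝓝[>] t) (hr : c < r) : ∀ᶠ s in 𝓝[>] t, slope φ t s < r := by
  obtain ⟨ψ, d, hle, heq, hψ, hd⟩ := hφ
  have hslope : Tendsto (slope ψ t) (𝓝[>] t) (𝓝 d) :=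
    (hasDerivWithinAt_iff_tendsto_slope' self_notMem_Ioi).1 (hψ.mono_of_mem_nhdsWithin hI)
  filter_upwards [hslope.eventually_lt_const (hd.trans_lt hr), hI, self_mem_nhdsWithin]
    with s hs hsI (hts : t < s)
  refine lt_of_le_of_lt ?_ hs
  have : 0 < s - t := sub_pos.2 hts
  have := hle s hsI
  rw [slope_def_field, slope_def_field, heq]
  gcongr

theorem le_add_mul_of_hasUpperSupport (hφ : ContinuousOn φ (Icc a b))
    (hsupp : ∀ t ∈ Ico a b, HasUpperSupport φ (Icc a b) t c) (ht : t ∈ Icc a b) :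
    φ t ≤ φ a + c * (t - a) := by
  refine image_le_of_liminf_slope_right_le_deriv_boundary (B := fun t => φ a + c * (t - a))
    (B' := fun _ => c) hφ (by simp) (by fun_prop) (fun t _ => ?_) (fun t ht r hr => ?_) ht
  · simpa using (((hasDerivWithinAt_id t (Ici t)).sub_const a).const_mul c).const_add (φ a)
  · exact ((hsupp t ht).eventually_slope_lt (Icc_mem_nhdsGT_of_mem ht) hr).frequently

theorem HasUpperSupport.upperRightDini_le (hφ : HasUpperSupport φ I 0 c) (hI : I ∈ 𝓝[>] 0) :
    upperRightDini φ ≤ (c : EReal) := by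
  refine EReal.le_of_forall_lt_iff_le.1 fun r hr => ?_
  refine limsup_le_of_le ?_ ?_
  · isBoundedDefault
  filter_upwards [hφ.eventually_slope_lt hI (EReal.coe_lt_coe_iff.1 hr)] with s hs
  simpa [slope_def_field] using hs.le

theorem nonpos_of_hasDerivWithinAt_le_mul {φ' : ℝ → ℝ} {K : ℝ}
    (hφ : ∀ t ∈ Icc a b, HasDerivWithinAt φ (φ' t) (Icc a b) t)
    (hle : ∀ t ∈ Icc a b, φ' t ≤ K * φ t) (ha : φ a ≤ 0) (ht : t ∈ Icc a b) : φ t ≤ 0 := by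
  have hgronwall := le_gronwallBound_of_liminf_deriv_right_le (f' := φ') (K := K) (ε := 0)
    (fun t ht => (hφ t ht).continuousWithinAt)
    (fun t ht r hr => by
      simpa only [slope_def_module, smul_eq_mul] using
        ((hφ t (Ico_subset_Icc_self ht)).mono_of_mem_nhdsWithin
          (Icc_mem_nhdsGE_of_mem ht)).liminf_right_slope_le hr)
    ha (fun t ht => by simpa using hle t (Ico_subset_Icc_self ht)) t ht
  rwa [gronwallBound_ε0_δ0] at hgronwall

end DifferentialInequalities

/-! ### Peano's existence theorem -/

section Peano

variable {G : Type*} [NormedAddCommGroup G] [NormedSpace ℝ G] {f : G → G} {M : ℝ} {x₀ : G}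

/-- The nodes of the explicit Euler scheme with step size `h` for `x' = f(x)`, `x(0) = x₀`. -/
def eulerNode (f : G → G) (h : ℝ) (x₀ : G) : ℕ → G
  | 0 => x₀
  | i + 1 => eulerNode f h x₀ i + h • f (eulerNode f h x₀ i)

theorem norm_eulerNode_sub_le_of_le {h : ℝ} (hh : 0 ≤ h) {v : G} {ε : ℝ} {l k : ℕ} (hlk : l ≤ k)
    (hv : ∀ i, l ≤ i → i < k → ‖f (eulerNode f h x₀ i) - v‖ ≤ ε) :
    ‖eulerNode f h x₀ k - eulerNode f h x₀ l - (((k : ℝ) - l) * h) • v‖ ≤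
      ε * (((k : ℝ) - l) * h) := by
  induction k, hlk using Nat.le_induction with
  | base => simp
  | succ k hlk ih =>
    have hk := ih fun i hli hik => hv i hli (hik.trans k.lt_succ_self)
    have hstep := mul_le_mul_of_nonneg_left (hv k hlk k.lt_succ_self) hh
    calc ‖eulerNode f h x₀ (k + 1) - eulerNode f h x₀ l - ((((k + 1 : ℕ) : ℝ) - l) * h) • v‖
        = ‖(eulerNode f h x₀ k - eulerNode f h x₀ l - (((k : ℝ) - l) * h) • v)
          + h • (f (eulerNode f h x₀ k) - v)‖ := by
          congr 1; rw [eulerNode]; push_cast; module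
      _ ≤ ε * (((k : ℝ) - l) * h) + h * ε := by
          refine norm_add_le_of_le hk ?_
          rwa [norm_smul, Real.norm_of_nonneg hh]
      _ = ε * ((((k + 1 : ℕ) : ℝ) - l) * h) := by push_cast; ring

theorem norm_eulerNode_sub_le {h : ℝ} (hh : 0 ≤ h) {v : G} {ε : ℝ} {l k : ℕ}
    (hv : ∀ i ∈ uIcc l k, ‖f (eulerNode f h x₀ i) - v‖ ≤ ε) :
    ‖eulerNode f h x₀ k - eulerNode f h x₀ l - (((k : ℝ) - l) * h) • v‖ ≤
      ε * (|(k : ℝ) - l| * h) := by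
  rcases le_total l k with hlk | hkl
  · rw [abs_of_nonneg (by simpa using hlk)]
    exact norm_eulerNode_sub_le_of_le hh hlk fun i hli hik =>
      hv i (mem_uIcc_of_le hli hik.le)
  · rw [abs_of_nonpos (by simpa using hkl), ← norm_neg]
    convert norm_eulerNode_sub_le_of_le hh hkl fun i hki hil =>
      hv i (mem_uIcc_of_ge hki hil.le) using 1
    · congr 1; module
    · ring

theorem norm_eulerNode_sub_le_mul (hM : ∀ x, ‖f x‖ ≤ M) {h : ℝ} (hh : 0 ≤ h) (l k : ℕ) :
    ‖eulerNode f h x₀ k - eulerNode f h x₀ l‖ ≤ M * (|(k : ℝ) - l| * h) := by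
  simpa using norm_eulerNode_sub_le (x₀ := x₀) hh (v := 0) (l := l) (k := k)
    fun i _ => (sub_zero (f _)).symm ▸ hM _

/-- The Euler approximation with step size `1 / N`, constant between the nodes. -/
def eulerPath (f : G → G) (x₀ : G) (N : ℕ) (t : ℝ) : G :=
  eulerNode f (N : ℝ)⁻¹ x₀ ⌊t * N⌋₊

theorem tendsto_floor_mul_inv {t : ℝ} (ht : 0 ≤ t) :
    Tendsto (fun N : ℕ => (⌊t * N⌋₊ : ℝ) * (N : ℝ)⁻¹) atTop (𝓝 t) := by
  simpa only [div_eq_mul_inv, Function.comp_def] using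
    (tendsto_nat_floor_mul_div_atTop ht).comp tendsto_natCast_atTop_atTop

theorem exists_tendsto_eulerPath [ProperSpace G] (hM : ∀ x, ‖f x‖ ≤ M) {U : Ultrafilter ℕ}
    (hU : ↑U ≤ (atTop : Filter ℕ)) {t : ℝ} (ht : 0 ≤ t) :
    ∃ z, Tendsto (fun N => eulerPath f x₀ N t) U (𝓝 z) := by
  have hbound : ∀ᶠ N in U, eulerPath f x₀ N t ∈ Metric.closedBall x₀ (M * (t + 1)) := by
    have := (tendsto_floor_mul_inv ht).eventually_le_const (lt_add_one t)
    filter_upwards [hU this] with N hN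
    have hM0 : 0 ≤ M := (norm_nonneg _).trans (hM 0)
    have hpath := norm_eulerNode_sub_le_mul (x₀ := x₀) hM (inv_nonneg.2 N.cast_nonneg) 0 ⌊t * N⌋₊
    rw [Nat.cast_zero, sub_zero, Nat.abs_cast] at hpath
    exact mem_closedBall_iff_norm.2 (hpath.trans (mul_le_mul_of_nonneg_left hN hM0))
  obtain ⟨z, -, hz⟩ := (isCompact_closedBall x₀ (M * (t + 1))).ultrafilter_le_nhds
    (U.map fun N => eulerPath f x₀ N t) (le_principal_iff.2 hbound)
  exact ⟨z, hz⟩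

theorem norm_sub_sub_smul_le_of_tendsto_eulerPath (hM : ∀ x, ‖f x‖ ≤ M) {l : Filter ℕ} [NeBot l]
    (hl : l ≤ atTop) {x : ℝ → G}
    (hx : ∀ t, 0 ≤ t → Tendsto (fun N => eulerPath f x₀ N t) l (𝓝 (x t)))
    {ε η s t : ℝ} (hs : 0 ≤ s) (ht : 0 ≤ t) (hf : ∀ z, ‖z - x t‖ < η → ‖f z - f (x t)‖ ≤ ε)
    (hst : M * |s - t| < η) :
    ‖x s - x t - (s - t) • f (x t)‖ ≤ ε * |s - t| := by
  have hdiff : Tendsto (fun N : ℕ => ((⌊s * N⌋₊ : ℝ) - ⌊t * N⌋₊) * (N : ℝ)⁻¹) l (𝓝 (s - t)) := by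
    simpa only [sub_mul] using
      ((tendsto_floor_mul_inv hs).sub (tendsto_floor_mul_inv ht)).mono_left hl
  have habs : Tendsto (fun N : ℕ => |(⌊s * N⌋₊ : ℝ) - ⌊t * N⌋₊| * (N : ℝ)⁻¹) l (𝓝 |s - t|) := by
    refine hdiff.abs.congr fun N => ?_
    rw [abs_mul, abs_of_nonneg (a := (N : ℝ)⁻¹) (inv_nonneg.2 N.cast_nonneg)]
  have hnear : ∀ᶠ N : ℕ in l,
      M * (|(⌊s * N⌋₊ : ℝ) - ⌊t * N⌋₊| * (N : ℝ)⁻¹) + ‖eulerPath f x₀ N t - x t‖ < η := by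
    refine ((habs.const_mul M).add ((hx t ht).sub_const (x t)).norm).eventually_lt_const ?_
    simpa using hst
  refine le_of_tendsto_of_tendsto
    (((hx s hs).sub (hx t ht)).sub (hdiff.smul_const (f (x t)))).norm (habs.const_mul ε) ?_
  filter_upwards [hnear] with N hN
  have hstep : (0 : ℝ) ≤ (N : ℝ)⁻¹ := inv_nonneg.2 N.cast_nonneg
  refine norm_eulerNode_sub_le hstep fun i hi => hf _ (lt_of_le_of_lt ?_ hN)
  have hi' : |(i : ℝ) - ⌊t * N⌋₊| ≤ |(⌊s * N⌋₊ : ℝ) - ⌊t * N⌋₊| :=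
    abs_sub_left_of_mem_uIcc (Nat.mono_cast.mapsTo_uIcc hi)
  have hM0 : 0 ≤ M := (norm_nonneg _).trans (hM 0)
  refine (norm_sub_le_norm_sub_add_norm_sub _ (eulerPath f x₀ N t) _).trans
    (add_le_add_left ((norm_eulerNode_sub_le_mul hM hstep _ _).trans ?_) _)
  gcongr

theorem exists_forall_hasDerivWithinAt_of_continuous_of_bounded [FiniteDimensional ℝ G]
    (hf : Continuous f) (hM : ∀ x, ‖f x‖ ≤ M) (x₀ : G) :
    ∃ x : ℝ → G, x 0 = x₀ ∧ ∀ t ∈ Ici (0 : ℝ), HasDerivWithinAt x (f (x t)) (Ici 0) t := by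
  have : ProperSpace G := FiniteDimensional.proper ℝ G
  have hU : ↑(hyperfilter ℕ) ≤ (atTop : Filter ℕ) := Nat.hyperfilter_le_atTop
  choose! x hx using fun t : ℝ => exists_tendsto_eulerPath (x₀ := x₀) hM hU (t := t)
  refine ⟨x, tendsto_nhds_unique (hx 0 le_rfl) (by simp [eulerPath, eulerNode]), fun t ht => ?_⟩
  rw [hasDerivWithinAt_iff_isLittleO, Asymptotics.isLittleO_iff]
  intro ε hε
  obtain ⟨η, hη, hfη⟩ := Metric.continuousAt_iff.1 (hf.continuousAt (x := x t)) ε hε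
  have hnear : ∀ᶠ s in 𝓝[Ici 0] t, M * |s - t| < η := by
    have : Tendsto (fun s => M * |s - t|) (𝓝[Ici 0] t) (𝓝 (M * |t - t|)) :=
      Continuous.continuousWithinAt (by fun_prop)
    exact this.eventually_lt_const (by simpa using hη)
  filter_upwards [hnear, self_mem_nhdsWithin] with s hs hs0
  refine norm_sub_sub_smul_le_of_tendsto_eulerPath hM hU hx hs0 ht (fun z hz => ?_) hs
  simpa only [dist_eq_norm] using (hfη (by rwa [dist_eq_norm])).le

end Peano

/-! ### Nearest points of convex sets -/

section NearestPoint

variable {G : Type*} [NormedAddCommGroup G] [InnerProductSpace ℝ G] {S : Set G} {u u' p p' ζ : G}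

/-- `p` is the point of the convex set `S` nearest to `u`, expressed by the variational inequality
that characterizes it. Both the projection onto the constraint set and the closed-loop velocity,
which is the projection of `-F x` onto the restricted tangent set, are of this kind. -/
def IsNearestPoint (S : Set G) (u p : G) : Prop :=
  p ∈ S ∧ ∀ ζ ∈ S, ⟪u - p, ζ - p⟫ ≤ 0

theorem exists_isNearestPoint [CompleteSpace G] (hne : S.Nonempty) (hcl : IsClosed S)
    (hconv : Convex ℝ S) (u : G) : ∃ p, IsNearestPoint S u p :=
  let ⟨p, hp, hinf⟩ := exists_norm_eq_iInf_of_complete_convex hne hcl.isComplete hconv u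
  ⟨p, hp, (norm_eq_iInf_iff_real_inner_le_zero hconv hp).1 hinf⟩

namespace IsNearestPoint

theorem of_mem (hu : u ∈ S) : IsNearestPoint S u u :=
  ⟨hu, fun ζ _ => by simp⟩

theorem norm_sub_sq_add_norm_sub_sq_le (hp : IsNearestPoint S u p) (hζ : ζ ∈ S) :
    ‖u - p‖ ^ 2 + ‖ζ - p‖ ^ 2 ≤ ‖u - ζ‖ ^ 2 := by
  rw [← sub_sub_sub_cancel_right u ζ p, norm_sub_sq_real (u - p)]
  linarith [hp.2 ζ hζ]

theorem norm_sub_le (hp : IsNearestPoint S u p) (hζ : ζ ∈ S) : ‖ζ - p‖ ≤ ‖u - ζ‖ :=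
  le_of_sq_le_sq (by linarith [hp.norm_sub_sq_add_norm_sub_sq_le hζ, sq_nonneg ‖u - p‖])
    (norm_nonneg _)

theorem norm_sub_le_norm_sub (hp : IsNearestPoint S u p) (hp' : IsNearestPoint S u' p') :
    ‖p - p'‖ ≤ ‖u - u'‖ := by
  have hsq : ‖p - p'‖ ^ 2 ≤ ⟪u - u', p - p'⟫ := by
    have h := hp.2 p' hp'.1
    have h' := hp'.2 p hp.1
    rw [← real_inner_self_eq_norm_sq]
    simp only [inner_sub_left, inner_sub_right] at *
    linarith
  have := real_inner_le_norm (u - u') (p - p')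
  by_contra! hlt
  nlinarith [norm_nonneg (u - u'), norm_nonneg (p - p')]

theorem unique (hp : IsNearestPoint S u p) (hp' : IsNearestPoint S u p') : p = p' := by
  simpa [sub_eq_zero] using hp.norm_sub_le_norm_sub hp'

theorem continuous {P : G → G} (hP : ∀ x, IsNearestPoint S x (P x)) : Continuous P :=
  (LipschitzWith.of_dist_le' (K := 1) fun x y => by
    simpa [dist_eq_norm] using (hP x).norm_sub_le_norm_sub (hP y)).continuous

/-- A pointwise form of the continuity of nearest points under Kuratowski convergence of the
sets: limits of the nearest points are required to lie in `S₀`, and `p₀` is required to be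
approximable by points that eventually belong to the sets. -/
theorem tendsto [ProperSpace G] {X : Type*} {l : Filter X} {S : X → Set G} {S₀ : Set G}
    {u p : X → G} {u₀ p₀ : G} (hp : ∀ᶠ y in l, IsNearestPoint (S y) (u y) (p y))
    (hp₀ : IsNearestPoint S₀ u₀ p₀) (hu : Tendsto u l (𝓝 u₀))
    (hupper : ∀ (U : Ultrafilter X) (w : G), ↑U ≤ l → Tendsto p U (𝓝 w) → w ∈ S₀)
    (hlower : p₀ ∈ closure {θ | ∀ᶠ y in l, θ ∈ S y}) : Tendsto p l (𝓝 p₀) := by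
  obtain ⟨θ₀, hθ₀⟩ := closure_nonempty_iff.1 ⟨p₀, hlower⟩
  have hbound : ∀ᶠ y in l, p y ∈ Metric.closedBall θ₀ (‖u₀ - θ₀‖ + 1) := by
    have hball := (hu.sub_const θ₀).norm.eventually_le_const (lt_add_one _)
    filter_upwards [hp, hθ₀, hball] with y hpy hθy hy
    exact mem_closedBall_iff_norm'.2 ((hpy.norm_sub_le hθy).trans hy)
  refine tendsto_iff_ultrafilter _ _ _ |>.2 fun U hU => ?_
  obtain ⟨w, -, hw : Tendsto p U (𝓝 w)⟩ :=
    (isCompact_closedBall θ₀ (‖u₀ - θ₀‖ + 1)).ultrafilter_le_nhds (U.map p)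
      (le_principal_iff.2 (hU hbound))
  have hvar : ⟪u₀ - w, p₀ - w⟫ ≤ 0 := by
    have hclosed : IsClosed {θ | ⟪u₀ - w, θ - w⟫ ≤ 0} :=
      isClosed_le (by fun_prop) continuous_const
    refine closure_minimal (fun θ hθ => ?_) hclosed hlower
    refine le_of_tendsto (((hu.mono_left hU).sub hw).inner (𝕜 := ℝ) (hw.const_sub θ)) (hU ?_)
    filter_upwards [hp, hθ] with y hpy hθy using hpy.2 θ hθy
  have hvar₀ := hp₀.2 w (hupper U w hU hw)
  have hwp : ‖p₀ - w‖ ^ 2 ≤ 0 := by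
    rw [← real_inner_self_eq_norm_sq]
    simp only [inner_sub_left, inner_sub_right] at *
    linarith
  rwa [sub_eq_zero.1 (norm_eq_zero.1 (sq_nonpos_iff _ |>.1 hwp))]

end IsNearestPoint

theorem mem_of_forall_inner_velocity_nonpos {P : G → G} (hP : ∀ x, IsNearestPoint S x (P x))
    {x v : ℝ → G} {T : ℝ} (hx : ∀ t ∈ Icc 0 T, HasDerivWithinAt x (v t) (Icc 0 T) t)
    (hv : ∀ t ∈ Icc 0 T, ⟪x t - P (x t), v t⟫ ≤ 0) (h0 : x 0 ∈ S) {t : ℝ} (ht : t ∈ Icc 0 T) :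
    x t ∈ S := by
  have hxc : ContinuousOn x (Icc 0 T) := fun t ht => (hx t ht).continuousWithinAt
  have hdist : ‖x t - P (x t)‖ ^ 2 ≤ ‖x 0 - P (x 0)‖ ^ 2 + 0 * (t - 0) := by
    refine le_add_mul_of_hasUpperSupport (φ := fun t => ‖x t - P (x t)‖ ^ 2) ?_ (fun t ht => ?_) ht
    · exact (hxc.sub ((IsNearestPoint.continuous hP).comp_continuousOn hxc)).norm.pow 2
    have htI : t ∈ Icc 0 T := Ico_subset_Icc_self ht
    refine ⟨fun s => ‖x s - P (x t)‖ ^ 2, 2 * ⟪x t - P (x t), v t⟫, fun s _ => ?_, rfl,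
      ((hx t htI).sub_const _).norm_sq, by linarith [hv t htI]⟩
    linarith [(hP (x s)).norm_sub_sq_add_norm_sub_sq_le (hP (x t)).1,
      sq_nonneg ‖P (x t) - P (x s)‖]
  rw [(hP _).unique (.of_mem h0), sub_self] at hdist
  have : ‖x t - P (x t)‖ ^ 2 ≤ 0 := by simpa using hdist
  rw [sub_eq_zero.1 (norm_eq_zero.1 (sq_nonpos_iff _ |>.1 this))]
  exact (hP _).1

end NearestPoint

/-! ### Gradients and monotone maps -/

section Gradient

variable {G : Type*} [NormedAddCommGroup G] [InnerProductSpace ℝ G]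

theorem inner_gradient_le_sub [CompleteSpace G] {f : G → ℝ} (hf : ConvexOn ℝ univ f) {x : G}
    (hd : DifferentiableAt ℝ f x) (y : G) : ⟪∇ f x, y - x⟫ ≤ f y - f x := by
  rw [inner_gradient_left]
  refine le_of_tendsto (hd.hasFDerivAt.hasLineDerivAt (y - x)).tendsto_slope_zero_right ?_
  filter_upwards [Ioo_mem_nhdsGT (zero_lt_one' ℝ)] with t ht
  have hconv := hf.2 (mem_univ x) (mem_univ y) (sub_nonneg.2 ht.2.le) ht.1.le (by ring)
  rw [show (1 - t) • x + t • y = x + t • (y - x) by module] at hconv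
  rw [smul_eq_mul, inv_mul_le_iff₀ ht.1]
  simp only [smul_eq_mul] at hconv
  linarith

theorem inner_sub_nonneg_of_forall_inner_le_sub {f : G → ℝ} {φ : G → G}
    (hφ : ∀ x y, ⟪φ x, y - x⟫ ≤ f y - f x) (x y : G) : 0 ≤ ⟪x - y, φ x - φ y⟫ := by
  have hxy := hφ x y
  have hyx := hφ y x
  rw [real_inner_comm] at hxy hyx
  simp only [inner_sub_left, inner_sub_right] at *
  linarith

theorem mul_norm_sq_le_inner_fderiv {F : G → G} {μ : ℝ}
    (hF : ∀ x y, μ * ‖x - y‖ ^ 2 ≤ ⟪x - y, F x - F y⟫) {x : G} (hd : DifferentiableAt ℝ F x)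
    (ξ : G) : μ * ‖ξ‖ ^ 2 ≤ ⟪ξ, fderiv ℝ F x ξ⟫ := by
  refine ge_of_tendsto (Tendsto.inner (𝕜 := ℝ) tendsto_const_nhds
    (hd.hasFDerivAt.hasLineDerivAt ξ).tendsto_slope_zero_right) ?_
  filter_upwards [self_mem_nhdsWithin] with t (ht : 0 < t)
  have hmono := hF (x + t • ξ) x
  rw [add_sub_cancel_left, norm_smul, real_inner_smul_left, mul_pow, Real.norm_of_nonneg ht.le]
    at hmono
  rw [inner_smul_right, le_inv_mul_iff₀ ht]
  refine le_of_mul_le_mul_left ?_ ht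
  linarith

theorem eventually_add_smul_neg [CompleteSpace G] {f : G → ℝ} {x ξ : G}
    (hd : DifferentiableAt ℝ f x) (hx : f x ≤ 0) (hξ : f x = 0 → ⟪∇ f x, ξ⟫ < 0) :
    ∀ᶠ t : ℝ in 𝓝[>] 0, f (x + t • ξ) < 0 := by
  rcases hx.eq_or_lt with h0 | hneg
  · have hslope := (hd.hasFDerivAt.hasLineDerivAt ξ).tendsto_slope_zero_right
    rw [← inner_gradient_left] at hslope
    filter_upwards [hslope.eventually_lt_const (hξ h0), self_mem_nhdsWithin] with t ht ht0
    rw [h0, sub_zero, smul_eq_mul] at ht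
    exact neg_of_mul_neg_right ht (inv_nonneg.2 (le_of_lt ht0))
  · have hline : Tendsto (fun t : ℝ => x + t • ξ) (𝓝[>] 0) (𝓝 x) :=
      Tendsto.mono_left (Continuous.tendsto' (by fun_prop) _ _ (by simp)) nhdsWithin_le_nhds
    exact (hd.continuousAt.tendsto.comp hline).eventually_lt_const hneg

theorem contDiff_gradient [CompleteSpace G] {f : G → ℝ} {r s : WithTop ℕ∞}
    (hf : ContDiff ℝ s f) (hrs : r + 1 ≤ s) : ContDiff ℝ r (∇ f) :=
  (InnerProductSpace.toDual ℝ G).symm.toContinuousLinearEquiv.contDiff.comp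
    (hf.fderiv_right hrs)

end Gradient

/-! ### Solutions that remain in a convex set -/

section Viability

variable {G : Type*} [NormedAddCommGroup G] [InnerProductSpace ℝ G] [FiniteDimensional ℝ G]

theorem exists_forall_mem_hasDerivWithinAt_smul {C : Set G} (hC : IsClosed C) (hconv : Convex ℝ C)
    {v : G → G} (hv : ContinuousOn v C) (htan : ∀ u x, IsNearestPoint C u x → ⟪u - x, v x⟫ ≤ 0)
    {χ : G → ℝ} (hχ : Continuous χ) (hχc : HasCompactSupport χ) (hχ0 : ∀ x, 0 ≤ χ x) {x₀ : G}
    (hx₀ : x₀ ∈ C) : ∃ x : ℝ → G, x 0 = x₀ ∧ (∀ t ∈ Ici (0 : ℝ), x t ∈ C) ∧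
      ∀ t ∈ Ici (0 : ℝ), HasDerivWithinAt x (χ (x t) • v (x t)) (Ici 0) t := by
  have : CompleteSpace G := FiniteDimensional.complete ℝ G
  choose P hP using exists_isNearestPoint ⟨x₀, hx₀⟩ hC hconv
  have hf : Continuous fun x => χ x • v (P x) :=
    hχ.smul (hv.comp_continuous (IsNearestPoint.continuous hP) fun x => (hP x).1)
  obtain ⟨M, hM⟩ := hf.bounded_above_of_compact_support hχc.smul_right
  obtain ⟨x, hx0, hx⟩ := exists_forall_hasDerivWithinAt_of_continuous_of_bounded hf hM x₀
  have hxC : ∀ t ∈ Ici (0 : ℝ), x t ∈ C := fun t ht =>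
    mem_of_forall_inner_velocity_nonpos (T := t) hP
      (fun s hs => (hx s hs.1).mono Icc_subset_Ici_self)
      (fun s _ => by
        rw [inner_smul_right]
        exact mul_nonpos_of_nonneg_of_nonpos (hχ0 _) (htan _ _ (hP _)))
      (hx0 ▸ hx₀) (right_mem_Icc.2 ht)
  refine ⟨x, hx0, hxC, fun t ht => ?_⟩
  have hxt := hx t ht
  rwa [(hP (x t)).unique (.of_mem (hxC t ht))] at hxt

end Viability

/-! ### Multipliers of linear constraints -/

section Multipliers

variable {G ι κ : Type*} [NormedAddCommGroup G] [InnerProductSpace ℝ G] [Fintype ι]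

theorem nonneg_and_mul_eq_zero_of_isMinOn_Ici {φ : ℝ → ℝ} {u d : ℝ} (hφ : HasDerivAt φ d u)
    (hu : 0 ≤ u) (hmin : IsMinOn φ (Ici 0) u) : 0 ≤ d ∧ u * d = 0 := by
  rcases hu.eq_or_lt with rfl | hpos
  · refine ⟨ge_of_tendsto ((hasDerivWithinAt_iff_tendsto_slope' self_notMem_Ioi).1
      hφ.hasDerivWithinAt) ?_, zero_mul d⟩
    filter_upwards [self_mem_nhdsWithin] with s (hs : 0 < s)
    rw [slope_def_field]
    exact div_nonneg (sub_nonneg.2 (hmin hs.le)) (by simpa using hs.le)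
  · have hd : d = 0 := (hmin.isLocalMin (Ici_mem_nhds hpos)).hasDerivAt_eq_zero hφ
    simp [hd]

theorem hasDerivAt_sum_update_smul [DecidableEq ι] (a : ι → G) (u : ι → ℝ) (i : ι) (s : ℝ) :
    HasDerivAt (fun s => ∑ j, Function.update u i s j • a j) (a i) s := by
  simpa [Pi.single_apply] using HasDerivAt.fun_sum (u := Finset.univ) fun j _ =>
    (hasDerivAt_pi.1 (hasDerivAt_update u i s) j).smul_const (a j)

/-- The multipliers minimize the dual function, which the positivity of `b` makes coercive. -/
theorem exists_multipliers_of_pos (a : ι → G) {b : ι → ℝ} (hb : ∀ i, 0 < b i) (w : G) :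
    ∃ u : ι → ℝ, (∀ i, 0 ≤ u i) ∧ ∀ i, ⟪a i, -(w + ∑ j, u j • a j)⟫ ≤ b i ∧
      u i * (b i - ⟪a i, -(w + ∑ j, u j • a j)⟫) = 0 := by
  classical
  let q : (ι → ℝ) → ℝ := fun u => 1 / 2 * ‖w + ∑ j, u j • a j‖ ^ 2 + ∑ j, u j • b j
  have hcoercive : ∀ᶠ u in cocompact (ι → ℝ) ⊓ 𝓟 (Ici 0), q 0 ≤ q u := by
    have hbox : (Icc 0 fun i => q 0 / b i)ᶜ ∈ cocompact (ι → ℝ) := isCompact_Icc.compl_mem_cocompact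
    filter_upwards [inter_mem_inf hbox (mem_principal_self _)] with u ⟨hu, (hu0 : 0 ≤ u)⟩
    obtain ⟨i, hi⟩ : ∃ i, q 0 / b i < u i := by
      by_contra! hle
      exact hu ⟨hu0, hle⟩
    calc q 0 ≤ u i • b i := ((div_lt_iff₀ (hb i)).1 hi).le
      _ ≤ ∑ j, u j • b j := Finset.single_le_sum (f := fun j => u j • b j)
          (fun j _ => mul_nonneg (hu0 j) (hb j).le) (Finset.mem_univ i)
      _ ≤ q u := le_add_of_nonneg_left (by positivity)
  have hq : Continuous q := by fun_prop
  obtain ⟨u, hu0, hmin⟩ := hq.continuousOn.exists_isMinOn' isClosed_Ici self_mem_Ici hcoercive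
  refine ⟨u, hu0, fun i => ?_⟩
  have hderiv : HasDerivAt (fun s => q (Function.update u i s))
      (b i - ⟪a i, -(w + ∑ j, u j • a j)⟫) (u i) := by
    refine ((((hasDerivAt_sum_update_smul a u i (u i)).const_add w).norm_sq.const_mul
      (1 / 2 : ℝ)).add (hasDerivAt_sum_update_smul b u i (u i))).congr_deriv ?_
    rw [Function.update_eq_self, inner_neg_right, real_inner_comm]
    ring
  have hcoord : IsMinOn (fun s => q (Function.update u i s)) (Ici 0) (u i) := fun s hs => by
    simp only [Function.update_eq_self, mem_ofPred_eq]
    exact hmin (le_update_iff.2 ⟨hs, fun j _ => hu0 j⟩)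
  have := nonneg_and_mul_eq_zero_of_isMinOn_Ici hderiv (hu0 i) hcoord
  exact ⟨sub_nonneg.1 this.1, this.2⟩

/-- The equality constraints are eliminated by projecting onto the orthogonal complement of the
`h j`, and the strictly feasible point `ζ` is moved to the origin. -/
theorem exists_multipliers [Fintype κ] {a : ι → G} {h : κ → G} {b : ι → ℝ} {d : κ → ℝ} {ζ : G}
    (hζ : ∀ i, ⟪a i, ζ⟫ < b i) (hζ' : ∀ j, ⟪h j, ζ⟫ = d j) (w : G) :
    ∃ (u : ι → ℝ) (v : κ → ℝ) (ξ : G), ξ = -w - (∑ i, u i • a i + ∑ j, v j • h j) ∧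
      (∀ i, 0 ≤ u i) ∧ (∀ i, ⟪a i, ξ⟫ ≤ b i) ∧ (∀ j, ⟪h j, ξ⟫ = d j) ∧
      ∀ i, u i * (b i - ⟪a i, ξ⟫) = 0 := by
  let L : Submodule ℝ G := Submodule.span ℝ (range h)
  have : FiniteDimensional ℝ L := FiniteDimensional.span_of_finite ℝ (finite_range h)
  let P := Lᗮ.starProjection
  obtain ⟨u, hu, hP⟩ := exists_multipliers_of_pos (fun i => P (a i)) (fun i => sub_pos.2 (hζ i))
    (P (w + ζ))
  let y := w + ζ + ∑ i, u i • a i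
  have hPy : P (w + ζ) + ∑ i, u i • P (a i) = P y := by
    simp only [y, map_add, map_sum, map_smul]
  have hinner : ∀ i, ⟪P (a i), -P y⟫ = ⟪a i, ζ - P y⟫ - ⟪a i, ζ⟫ := fun i => by
    rw [inner_neg_right, inner_sub_right, Submodule.inner_starProjection_left_eq_right,
      Submodule.starProjection_eq_self_iff.2 (Submodule.starProjection_apply_mem _ y)]
    ring
  obtain ⟨v, hv⟩ := (Submodule.mem_span_range_iff_exists_fun ℝ).1 (L.starProjection_apply_mem y)
  refine ⟨u, -v, ζ - P y, ?_, hu, fun i => ?_, fun j => ?_, fun i => ?_⟩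
  · rw [show P y = y - L.starProjection y from Submodule.starProjection_orthogonal_val y, ← hv]
    simp only [y, Pi.neg_apply, neg_smul, Finset.sum_neg_distrib]
    abel
  · have := (hP i).1
    rw [hPy, hinner] at this
    linarith
  · have : ⟪h j, P y⟫ = 0 :=
      (L.mem_orthogonal _).1 (Lᗮ.starProjection_apply_mem y) _ (Submodule.subset_span ⟨j, rfl⟩)
    rw [inner_sub_right, this, sub_zero, hζ']
  · have := (hP i).2
    rwa [hPy, hinner, sub_sub_sub_cancel_right] at this

end Multipliers

variable {n m k : ℕ}

/-! ### The constraint set -/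

theorem affineMap_eq_inner (H : Matrix (Fin k) (Fin n) ℝ) (c : Fin k → ℝ) (j : Fin k) (x : E n) :
    affineMap H c j x = ⟪(WithLp.toLp 2 (H j) : E n), x⟫ - c j := by
  simp [affineMap, Matrix.mulVec, dotProduct, PiLp.inner_apply, mul_comm]

theorem hasGradientAt_affineMap (H : Matrix (Fin k) (Fin n) ℝ) (c : Fin k → ℝ) (j : Fin k)
    (x : E n) : HasGradientAt (affineMap H c j) (WithLp.toLp 2 (H j)) x := by
  rw [hasGradientAt_iff_hasFDerivAt, funext (affineMap_eq_inner H c j)]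
  exact (InnerProductSpace.toDual ℝ (E n) _).hasFDerivAt.sub_const _

theorem differentiable_affineMap (H : Matrix (Fin k) (Fin n) ℝ) (c : Fin k → ℝ) (j : Fin k) :
    Differentiable ℝ (affineMap H c j) :=
  fun x => (hasGradientAt_affineMap H c j x).differentiableAt

theorem gradient_affineMap (H : Matrix (Fin k) (Fin n) ℝ) (c : Fin k → ℝ) (j : Fin k) (x : E n) :
    ∇ (affineMap H c j) x = WithLp.toLp 2 (H j) :=
  (hasGradientAt_affineMap H c j x).gradient

theorem inner_gradient_affineMap_sub (H : Matrix (Fin k) (Fin n) ℝ) (c : Fin k → ℝ) (j : Fin k)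
    (x y z : E n) :
    ⟪∇ (affineMap H c j) z, y - x⟫ = affineMap H c j y - affineMap H c j x := by
  rw [gradient_affineMap, affineMap_eq_inner, affineMap_eq_inner, inner_sub_right]
  ring

section ConstraintSet

variable {α : ℝ} {g : Fin m → E n → ℝ} {h : Fin k → E n → ℝ} {H : Matrix (Fin k) (Fin n) ℝ}
  {c : Fin k → ℝ} {x ξ : E n}

theorem isClosed_constraintSet (hg : ∀ i, Continuous (g i)) (hh : ∀ j, Continuous (h j)) :
    IsClosed (constraintSet g h) := by
  simp only [constraintSet, ofPred_and, ofPred_forall]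
  exact (isClosed_iInter fun i => isClosed_le (hg i) continuous_const).inter
    (isClosed_iInter fun j => isClosed_eq (hh j) continuous_const)

theorem convex_constraintSet (hg : ∀ i, ConvexOn ℝ univ (g i)) :
    Convex ℝ (constraintSet g (affineMap H c)) := by
  intro x hx y hy a b ha hb hab
  refine ⟨fun i => ?_, fun j => ?_⟩
  · have hconv := (hg i).2 (mem_univ x) (mem_univ y) ha hb hab
    simp only [smul_eq_mul] at hconv
    nlinarith [hx.1 i, hy.1 i]
  · have hxj := hx.2 j
    have hyj := hy.2 j
    rw [affineMap_eq_inner] at hxj hyj ⊢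
    rw [inner_add_right, inner_smul_right, inner_smul_right]
    linear_combination a * hxj + b * hyj + c j * hab

/-- Slater's condition: the inequality constraints are strictly feasible. For convex `g` and affine
`h` it follows from the Mangasarian-Fromovitz condition at a single point, and it is what the
analysis of the flow rests on. -/
def SlaterCondition (g : Fin m → E n → ℝ) (h : Fin k → E n → ℝ) : Prop :=
  ∃ z, (∀ i, g i z < 0) ∧ ∀ j, h j z = 0

theorem eventually_add_smul_strictly_feasible (hg : ∀ i, DifferentiableAt ℝ (g i) x)
    (hx : x ∈ constraintSet g (affineMap H c)) (hξ : ∀ i, g i x = 0 → ⟪∇ (g i) x, ξ⟫ < 0)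
    (hξ' : ∀ j, ⟪∇ (affineMap H c j) x, ξ⟫ = 0) :
    ∀ᶠ t : ℝ in 𝓝[>] 0, (∀ i, g i (x + t • ξ) < 0) ∧ ∀ j, affineMap H c j (x + t • ξ) = 0 := by
  filter_upwards [eventually_all.2 fun i => eventually_add_smul_neg (hg i) (hx.1 i) (hξ i)]
    with t ht
  refine ⟨ht, fun j => ?_⟩
  have hsub := inner_gradient_affineMap_sub H c j x (x + t • ξ) x
  rwa [add_sub_cancel_left, inner_smul_right, hξ' j, mul_zero, hx.2 j, sub_zero, eq_comm] at hsub

theorem slaterCondition_of_mfcqAt (hg : ∀ i, DifferentiableAt ℝ (g i) x)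
    (hx : x ∈ constraintSet g (affineMap H c)) (hM : MFCQAt g (affineMap H c) x) :
    SlaterCondition g (affineMap H c) :=
  let ⟨_, hξ, hξ'⟩ := hM.2
  let ⟨_, ht⟩ := (eventually_add_smul_strictly_feasible hg hx hξ hξ').exists
  ⟨_, ht⟩

/-! ### The restricted tangent set -/

/-- The vectors satisfying the inequalities of the `α`-restricted tangent set strictly. They are
what persists at nearby points. -/
def strictTangentSet (α : ℝ) (g : Fin m → E n → ℝ) (h : Fin k → E n → ℝ) (x : E n) : Set (E n) :=
  {ξ | (∀ i, ⟪∇ (g i) x, ξ⟫ < -α * g i x) ∧ ∀ j, ⟪∇ (h j) x, ξ⟫ = -α * h j x}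

theorem zero_mem_restrictedTangentSet (hα : 0 ≤ α) (hx : x ∈ constraintSet g h) :
    (0 : E n) ∈ restrictedTangentSet α g h x := by
  refine ⟨fun i => ?_, fun j => ?_⟩
  · rw [inner_zero_right]
    exact mul_nonneg_of_nonpos_of_nonpos (neg_nonpos.2 hα) (hx.1 i)
  · rw [inner_zero_right, hx.2 j, mul_zero]

theorem strictTangentSet_nonempty (hα : 0 < α) (hg : ∀ i, ConvexOn ℝ univ (g i))
    (hd : ∀ i, DifferentiableAt ℝ (g i) x) (hS : SlaterCondition g (affineMap H c)) :
    (strictTangentSet α g (affineMap H c) x).Nonempty := by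
  obtain ⟨z, hz, hz'⟩ := hS
  refine ⟨α • (z - x), fun i => ?_, fun j => ?_⟩
  · rw [inner_smul_right]
    nlinarith [inner_gradient_le_sub (hg i) (hd i) z, hz i]
  · rw [inner_smul_right, inner_gradient_affineMap_sub, hz' j]
    ring

theorem restrictedTangentSet_subset_closure (hne : (strictTangentSet α g h x).Nonempty) :
    restrictedTangentSet α g h x ⊆ closure (strictTangentSet α g h x) := by
  obtain ⟨ζ, hζ, hζ'⟩ := hne
  intro ξ hξ
  have hlim : Tendsto (fun ε : ℝ => ξ + ε • (ζ - ξ)) (𝓝[>] 0) (𝓝 ξ) :=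
    Tendsto.mono_left (Continuous.tendsto' (by fun_prop) _ _ (by simp)) nhdsWithin_le_nhds
  refine mem_closure_of_tendsto hlim ?_
  filter_upwards [Ioo_mem_nhdsGT (zero_lt_one' ℝ)] with ε hε
  refine ⟨fun i => ?_, fun j => ?_⟩
  · simp only [inner_add_right, inner_smul_right, inner_sub_right]
    nlinarith [hξ.1 i, hζ i, hε.1, hε.2]
  · simp only [inner_add_right, inner_smul_right, inner_sub_right, hξ.2 j, hζ' j]
    ring

theorem inner_nonpos_of_mem_restrictedTangentSet (hg : ∀ i, DifferentiableAt ℝ (g i) x)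
    (hne : (strictTangentSet α g (affineMap H c) x).Nonempty) {u : E n}
    (hx : IsNearestPoint (constraintSet g (affineMap H c)) u x)
    (hξ : ξ ∈ restrictedTangentSet α g (affineMap H c) x) : ⟪u - x, ξ⟫ ≤ 0 := by
  have hclosed : IsClosed {ξ | ⟪u - x, ξ⟫ ≤ 0} := isClosed_le (by fun_prop) continuous_const
  refine closure_minimal (fun θ hθ => ?_) hclosed (restrictedTangentSet_subset_closure hne hξ)
  obtain ⟨t, ⟨hmem, hmem'⟩, ht⟩ := ((eventually_add_smul_strictly_feasible hg hx.1
    (fun i hi => by simpa [hi] using hθ.1 i) fun j => by rw [hθ.2 j, hx.1.2 j, mul_zero]).and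
      self_mem_nhdsWithin).exists
  have hinner := hx.2 _ ⟨fun i => (hmem i).le, hmem'⟩
  rw [add_sub_cancel_left, inner_smul_right] at hinner
  exact nonpos_of_mul_nonpos_right hinner ht

theorem eventually_mem_restrictedTangentSet (hg : ∀ i, ContinuousAt (g i) x)
    (hg' : ∀ i, ContinuousAt (∇ (g i)) x) (hx : x ∈ constraintSet g (affineMap H c))
    (hξ : ξ ∈ strictTangentSet α g (affineMap H c) x) :
    ∀ᶠ y in 𝓝[constraintSet g (affineMap H c)] x,
      ξ ∈ restrictedTangentSet α g (affineMap H c) y := by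
  have hineq : ∀ᶠ y in 𝓝 x, ∀ i, ⟪∇ (g i) y, ξ⟫ < -α * g i y := eventually_all.2 fun i =>
    ((hg' i).inner (𝕜 := ℝ) continuousAt_const).eventually_lt ((hg i).const_mul _) (hξ.1 i)
  filter_upwards [hineq.filter_mono nhdsWithin_le_nhds, self_mem_nhdsWithin] with y hy hyC
  refine ⟨fun i => (hy i).le, fun j => ?_⟩
  have hξj := hξ.2 j
  rwa [gradient_affineMap, hx.2 j, ← hyC.2 j, ← gradient_affineMap H c j y] at hξj

theorem mem_restrictedTangentSet_of_tendsto {X : Type*} {l : Filter X} [l.NeBot] {y θ : X → E n}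
    (hy : Tendsto y l (𝓝 x)) (hθ : Tendsto θ l (𝓝 ξ)) (hg : ∀ i, ContinuousAt (g i) x)
    (hg' : ∀ i, ContinuousAt (∇ (g i)) x) (hh : ∀ j, ContinuousAt (h j) x)
    (hh' : ∀ j, ContinuousAt (∇ (h j)) x)
    (hmem : ∀ᶠ z in l, θ z ∈ restrictedTangentSet α g h (y z)) :
    ξ ∈ restrictedTangentSet α g h x :=
  ⟨fun i => le_of_tendsto_of_tendsto (((hg' i).tendsto.comp hy).inner (𝕜 := ℝ) hθ)
      (((hg i).tendsto.comp hy).const_mul _) (hmem.mono fun _ hz => hz.1 i),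
    fun j => tendsto_nhds_unique_of_eventuallyEq (((hh' j).tendsto.comp hy).inner (𝕜 := ℝ) hθ)
      (((hh j).tendsto.comp hy).const_mul _) (hmem.mono fun _ hz => hz.2 j)⟩

end ConstraintSet

/-! ### Optimality conditions for the closed-loop velocity -/

section KKT

variable {α μ : ℝ} {F : E n → E n} {g : Fin m → E n → ℝ} {h : Fin k → E n → ℝ}
  {H : Matrix (Fin k) (Fin n) ℝ} {c : Fin k → ℝ} {p : (Fin m → ℝ) × (Fin k → ℝ)} {x ζ : E n}

/-- The combination `∑ uᵢ gᵢ + ∑ vⱼ hⱼ` of the constraint functions, whose gradient is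
`constraintForce`. -/
def weightedConstraint (g : Fin m → E n → ℝ) (h : Fin k → E n → ℝ)
    (p : (Fin m → ℝ) × (Fin k → ℝ)) (x : E n) : ℝ :=
  ∑ i, p.1 i * g i x + ∑ j, p.2 j * h j x

theorem weightedConstraint_nonpos (hp : ∀ i, 0 ≤ p.1 i) (hx : x ∈ constraintSet g h) :
    weightedConstraint g h p x ≤ 0 := by
  simp only [weightedConstraint, hx.2, mul_zero, Finset.sum_const_zero, add_zero]
  exact Finset.sum_nonpos fun i _ => mul_nonpos_of_nonneg_of_nonpos (hp i) (hx.1 i)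

theorem inner_constraintForce (g : Fin m → E n → ℝ) (h : Fin k → E n → ℝ) (x : E n)
    (p : (Fin m → ℝ) × (Fin k → ℝ)) (ζ : E n) :
    ⟪constraintForce g h x p, ζ⟫ =
      ∑ i, p.1 i * ⟪∇ (g i) x, ζ⟫ + ∑ j, p.2 j * ⟪∇ (h j) x, ζ⟫ := by
  simp only [constraintForce, inner_add_left, sum_inner, real_inner_smul_left]

theorem hasGradientAt_weightedConstraint (hg : ∀ i, DifferentiableAt ℝ (g i) x)
    (hh : ∀ j, DifferentiableAt ℝ (h j) x) (p : (Fin m → ℝ) × (Fin k → ℝ)) :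
    HasGradientAt (weightedConstraint g h p) (constraintForce g h x p) x := by
  rw [hasGradientAt_iff_hasFDerivAt]
  have hsum := (HasFDerivAt.fun_sum (u := Finset.univ) fun i _ =>
    (hg i).hasGradientAt.hasFDerivAt.const_mul (p.1 i)).add
      (HasFDerivAt.fun_sum (u := Finset.univ) fun j _ =>
        (hh j).hasGradientAt.hasFDerivAt.const_mul (p.2 j))
  refine hsum.congr_fderiv ?_
  simp only [constraintForce, map_add, map_sum, map_smul]

theorem inner_constraintForce_sub_le (hp : ∀ i, 0 ≤ p.1 i) (hg : ∀ i, ConvexOn ℝ univ (g i))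
    (hd : ∀ i, DifferentiableAt ℝ (g i) x) (y : E n) :
    ⟪constraintForce g (affineMap H c) x p, y - x⟫ ≤
      weightedConstraint g (affineMap H c) p y - weightedConstraint g (affineMap H c) p x := by
  simp only [inner_constraintForce, weightedConstraint, inner_gradient_affineMap_sub]
  rw [add_sub_add_comm, ← Finset.sum_sub_distrib, ← Finset.sum_sub_distrib]
  simp only [← mul_sub]
  gcongr with i
  · exact hp i
  · exact inner_gradient_le_sub (hg i) (hd i) y

theorem differentiable_constraintForce (hg' : ∀ i, Differentiable ℝ (∇ (g i)))
    (p : (Fin m → ℝ) × (Fin k → ℝ)) :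
    Differentiable ℝ fun x => constraintForce g (affineMap H c) x p := by
  simp only [constraintForce, gradient_affineMap]
  fun_prop

theorem differentiable_controlSystem (hF : Differentiable ℝ F)
    (hg' : ∀ i, Differentiable ℝ (∇ (g i))) (p : (Fin m → ℝ) × (Fin k → ℝ)) :
    Differentiable ℝ fun x => controlSystem F g (affineMap H c) x p :=
  hF.fun_neg.fun_sub (differentiable_constraintForce hg' p)

theorem mul_norm_sq_le_inner_controlSystem_sub (hFm : IsStronglyMonotoneMap μ F)
    (hgc : ∀ i, ConvexOn ℝ univ (g i)) (hg : ∀ i, Differentiable ℝ (g i))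
    (hp : ∀ i, 0 ≤ p.1 i) (x y : E n) :
    μ * ‖x - y‖ ^ 2 ≤ ⟪x - y,
      controlSystem F g (affineMap H c) y p - controlSystem F g (affineMap H c) x p⟫ := by
  have hforce := inner_sub_nonneg_of_forall_inner_le_sub
    (fun z => inner_constraintForce_sub_le (H := H) (c := c) hp hgc fun i => hg i z) x y
  calc μ * ‖x - y‖ ^ 2
      ≤ ⟪x - y, F x - F y⟫ + ⟪x - y, constraintForce g (affineMap H c) x p
          - constraintForce g (affineMap H c) y p⟫ := le_add_of_le_of_nonneg (hFm x y) hforce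
    _ = _ := by
        rw [← inner_add_right, controlSystem, controlSystem]
        congr 1
        abel

theorem inner_fderiv_controlSystem_le (hF : Differentiable ℝ F) (hFm : IsStronglyMonotoneMap μ F)
    (hgc : ∀ i, ConvexOn ℝ univ (g i)) (hg : ∀ i, Differentiable ℝ (g i))
    (hg' : ∀ i, Differentiable ℝ (∇ (g i))) (hp : ∀ i, 0 ≤ p.1 i) (x ξ : E n) :
    ⟪ξ, fderiv ℝ (fun x => controlSystem F g (affineMap H c) x p) x ξ⟫ ≤ -(μ * ‖ξ‖ ^ 2) := by
  have hneg := mul_norm_sq_le_inner_fderiv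
    (F := fun x => -controlSystem F g (affineMap H c) x p) (μ := μ)
    (fun y z => by
      rw [neg_sub_neg]
      exact mul_norm_sq_le_inner_controlSystem_sub hFm hgc hg hp y z)
    (differentiable_controlSystem hF hg' p x).fun_neg ξ
  rw [fderiv_fun_neg, neg_apply, inner_neg_right] at hneg
  linarith

/-- The optimality conditions of `min {½ ‖ξ + F(x)‖² | ξ ∈ T^(α)(x)}` for the multipliers `p`, with
`ξ = 𝓕(x, p)`. -/
structure IsKKT (α : ℝ) (F : E n → E n) (g : Fin m → E n → ℝ) (h : Fin k → E n → ℝ) (x : E n)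
    (p : (Fin m → ℝ) × (Fin k → ℝ)) : Prop where
  nonneg : ∀ i, 0 ≤ p.1 i
  mem : controlSystem F g h x p ∈ restrictedTangentSet α g h x
  compl : ∀ i, p.1 i * ⟪∇ (g i) x, controlSystem F g h x p⟫ = p.1 i * (-α * g i x)

theorem exists_isKKT (F : E n → E n) (hne : (strictTangentSet α g h x).Nonempty) :
    ∃ p, IsKKT α F g h x p := by
  obtain ⟨ζ, hζ, hζ'⟩ := hne
  obtain ⟨u, v, ξ, hξ, hu, hle, heq, hcompl⟩ := exists_multipliers hζ hζ' (F x)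
  change ξ = controlSystem F g h x (u, v) at hξ
  subst hξ
  exact ⟨(u, v), hu, ⟨hle, heq⟩, fun i => by linarith [hcompl i]⟩

theorem inner_constraintForce_le (hp : ∀ i, 0 ≤ p.1 i) (hζ : ζ ∈ restrictedTangentSet α g h x) :
    ⟪constraintForce g h x p, ζ⟫ ≤ -α * weightedConstraint g h p x := by
  rw [inner_constraintForce, weightedConstraint, mul_add, Finset.mul_sum, Finset.mul_sum]
  refine add_le_add (Finset.sum_le_sum fun i _ => ?_) (Finset.sum_le_sum fun j _ => ?_)
  · linarith [mul_le_mul_of_nonneg_left (hζ.1 i) (hp i)]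
  · rw [hζ.2 j, mul_left_comm]

namespace IsKKT

theorem inner_constraintForce_eq (hp : IsKKT α F g h x p) :
    ⟪constraintForce g h x p, controlSystem F g h x p⟫ = -α * weightedConstraint g h p x := by
  rw [inner_constraintForce, weightedConstraint, mul_add, Finset.mul_sum, Finset.mul_sum]
  simp only [hp.compl, hp.mem.2, mul_left_comm]

theorem isNearestPoint (hp : IsKKT α F g h x p) :
    IsNearestPoint (restrictedTangentSet α g h x) (-F x) (controlSystem F g h x p) := by
  refine ⟨hp.mem, fun ζ hζ => ?_⟩
  rw [show -F x - controlSystem F g h x p = constraintForce g h x p by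
    rw [controlSystem, sub_sub_cancel], inner_sub_right, hp.inner_constraintForce_eq]
  linarith [inner_constraintForce_le hp.nonneg hζ]

theorem safeMonotoneFlow_eq (hp : IsKKT α F g h x p) :
    safeMonotoneFlow α F g h x = {controlSystem F g h x p} := by
  have hcost : ∀ q, controlCost g h x q = 1 / 2 * ‖-F x - controlSystem F g h x q‖ ^ 2 :=
    fun q => by rw [controlCost, controlSystem, sub_sub_cancel]
  refine Subset.antisymm ?_ ?_
  · rintro _ ⟨q, hq, hmin, rfl⟩
    have hle := hmin p ⟨hp.nonneg, hp.mem⟩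
    have hpyth := hp.isNearestPoint.norm_sub_sq_add_norm_sub_sq_le hq.2
    rw [hcost, hcost] at hle
    have hsq : ‖controlSystem F g h x q - controlSystem F g h x p‖ ^ 2 ≤ 0 := by linarith
    exact sub_eq_zero.1 (norm_eq_zero.1 ((sq_nonpos_iff _).1 hsq))
  · rintro _ rfl
    refine ⟨p, ⟨hp.nonneg, hp.mem⟩, fun q hq => ?_, rfl⟩
    rw [hcost, hcost]
    linarith [hp.isNearestPoint.norm_sub_sq_add_norm_sub_sq_le hq.2,
      sq_nonneg ‖controlSystem F g h x q - controlSystem F g h x p‖]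

end IsKKT

end KKT

/-! ### The optimal value and the Lyapunov function -/

section LyapunovFunction

variable {α μ : ℝ} {F : E n → E n} {g : Fin m → E n → ℝ} {h : Fin k → E n → ℝ}
  {H : Matrix (Fin k) (Fin n) ℝ} {c : Fin k → ℝ} {p : (Fin m → ℝ) × (Fin k → ℝ)} {xs x : E n}

theorem optimalValue_eq_of_isNearestPoint {v : E n}
    (hv : IsNearestPoint (restrictedTangentSet α g h x) (-F x) v) :
    optimalValue α F g h x = ⟪v, F x⟫ + 1 / 2 * ‖v‖ ^ 2 := by
  refine IsLeast.csInf_eq ⟨⟨v, hv.1, rfl⟩, ?_⟩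
  rintro _ ⟨ζ, hζ, rfl⟩
  have hpyth := hv.norm_sub_sq_add_norm_sub_sq_le hζ
  simp only [norm_sub_sq_real (-F x), inner_neg_left, real_inner_comm _ (F x)] at hpyth
  dsimp only
  linarith [sq_nonneg ‖ζ - v‖]

/-- The value at the multipliers `p` of the Lagrangian dual of the program that defines
`optimalValue`. Unlike the optimal value it is differentiable in `x`. -/
def dualValue (α : ℝ) (F : E n → E n) (g : Fin m → E n → ℝ) (h : Fin k → E n → ℝ)
    (p : (Fin m → ℝ) × (Fin k → ℝ)) (x : E n) : ℝ :=
  α * weightedConstraint g h p x - 1 / 2 * ‖controlSystem F g h x p‖ ^ 2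

theorem dualValue_le_optimalValue (hp : ∀ i, 0 ≤ p.1 i)
    (hne : (restrictedTangentSet α g h x).Nonempty) :
    dualValue α F g h p x ≤ optimalValue α F g h x := by
  refine le_csInf (hne.image _) ?_
  rintro _ ⟨ζ, hζ, rfl⟩
  have hforce := inner_constraintForce_le hp hζ
  have hinner : ⟪ζ, controlSystem F g h x p⟫ = -⟪ζ, F x⟫ - ⟪constraintForce g h x p, ζ⟫ := by
    rw [controlSystem, inner_sub_right, inner_neg_right,
      real_inner_comm (constraintForce g h x p)]
  rw [dualValue]
  linarith [norm_sub_sq_real ζ (controlSystem F g h x p),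
    sq_nonneg ‖ζ - controlSystem F g h x p‖]

theorem IsKKT.optimalValue_eq_dualValue (hp : IsKKT α F g h x p) :
    optimalValue α F g h x = dualValue α F g h p x := by
  have hforce := hp.inner_constraintForce_eq
  have hF : ⟪controlSystem F g h x p, F x⟫ =
      -‖controlSystem F g h x p‖ ^ 2 - -α * weightedConstraint g h p x := by
    rw [← real_inner_self_eq_norm_sq, ← hforce, real_inner_comm _ (constraintForce g h x p),
      ← inner_neg_right, ← inner_sub_right, controlSystem]
    congr 1
    abel
  rw [optimalValue_eq_of_isNearestPoint hp.isNearestPoint, dualValue, hF]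
  ring

theorem IsKKT.optimalValue_nonpos (hα : 0 ≤ α) (hx : x ∈ constraintSet g h)
    (hp : IsKKT α F g h x p) : optimalValue α F g h x ≤ 0 := by
  rw [hp.optimalValue_eq_dualValue, dualValue]
  have := mul_nonpos_of_nonneg_of_nonpos hα (weightedConstraint_nonpos hp.nonneg hx)
  linarith [sq_nonneg ‖controlSystem F g h x p‖]

theorem half_norm_sq_le_lyapunovCandidate (hW : optimalValue α F g h x ≤ 0) (xs : E n) :
    1 / 2 * ‖x - xs‖ ^ 2 ≤ lyapunovCandidate α F g h xs x := by
  rw [lyapunovCandidate]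
  linarith [mul_nonpos_of_nonneg_of_nonpos (by positivity : 0 ≤ 1 / α ^ 2) hW]

theorem lyapunovCandidate_self (hα : 0 ≤ α) (hg : ∀ i, DifferentiableAt ℝ (g i) xs)
    (hne : (strictTangentSet α g (affineMap H c) xs).Nonempty)
    (hxs : xs ∈ viSol F (constraintSet g (affineMap H c))) :
    lyapunovCandidate α F g (affineMap H c) xs xs = 0 := by
  have hvi : IsNearestPoint (constraintSet g (affineMap H c)) (xs - F xs) xs :=
    ⟨hxs.1, fun y hy => by simpa [real_inner_comm] using hxs.2 y hy⟩
  have hzero : IsNearestPoint (restrictedTangentSet α g (affineMap H c) xs) (-F xs) 0 :=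
    ⟨zero_mem_restrictedTangentSet hα hxs.1, fun ζ hζ => by
      simpa using inner_nonpos_of_mem_restrictedTangentSet hg hne hvi hζ⟩
  simp [lyapunovCandidate, optimalValue_eq_of_isNearestPoint hzero]

theorem continuousOn_of_isNearestPoint_restrictedTangentSet (hα : 0 < α) (hF : Continuous F)
    (hgc : ∀ i, ConvexOn ℝ univ (g i)) (hg : ∀ i, Differentiable ℝ (g i))
    (hg' : ∀ i, Continuous (∇ (g i))) (hS : SlaterCondition g (affineMap H c)) {v : E n → E n}
    (hv : ∀ x, IsNearestPoint (restrictedTangentSet α g (affineMap H c) x) (-F x) (v x)) :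
    ContinuousOn v (constraintSet g (affineMap H c)) := by
  intro x hx
  have hne := strictTangentSet_nonempty hα hgc (fun i => hg i x) hS
  refine IsNearestPoint.tendsto (.of_forall hv) (hv x)
    ((hF.neg.tendsto x).mono_left nhdsWithin_le_nhds) (fun U w hU hw => ?_) ?_
  · exact mem_restrictedTangentSet_of_tendsto (hU.trans nhdsWithin_le_nhds : Tendsto id U (𝓝 x)) hw
      (fun i => (hg i).continuous.continuousAt) (fun i => (hg' i).continuousAt)
      (fun j => (differentiable_affineMap H c j).continuous.continuousAt)
      (fun j => by
        rw [funext (gradient_affineMap H c j)]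
        exact continuousAt_const)
      (.of_forall fun y => (hv y).1)
  · refine closure_mono (fun θ hθ => ?_) (restrictedTangentSet_subset_closure hne (hv x).1)
    exact eventually_mem_restrictedTangentSet (fun i => (hg i).continuous.continuousAt)
      (fun i => (hg' i).continuousAt) hx hθ

theorem continuousOn_lyapunovCandidate (hα : 0 < α) (hF : Continuous F)
    (hgc : ∀ i, ConvexOn ℝ univ (g i)) (hg : ∀ i, Differentiable ℝ (g i))
    (hg' : ∀ i, Continuous (∇ (g i))) (hS : SlaterCondition g (affineMap H c)) (xs : E n) :
    ContinuousOn (lyapunovCandidate α F g (affineMap H c) xs)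
      (constraintSet g (affineMap H c)) := by
  choose p hp using fun x =>
    exists_isKKT F (strictTangentSet_nonempty hα hgc (fun i => hg i x) hS)
  have hv := continuousOn_of_isNearestPoint_restrictedTangentSet hα hF hgc hg hg' hS
    fun x => (hp x).isNearestPoint
  have hW : ContinuousOn (optimalValue α F g (affineMap H c)) (constraintSet g (affineMap H c)) :=
    ((hv.inner (𝕜 := ℝ) hF.continuousOn).add (continuousOn_const.mul (hv.norm.pow 2))).congr
      fun x _ => optimalValue_eq_of_isNearestPoint (hp x).isNearestPoint
  exact (by fun_prop : Continuous fun x => 1 / 2 * ‖x - xs‖ ^ 2).continuousOn.sub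
    (continuousOn_const.mul hW)

theorem hasDerivWithinAt_dualValue (hF : Differentiable ℝ F) (hg : ∀ i, Differentiable ℝ (g i))
    (hg' : ∀ i, Differentiable ℝ (∇ (g i))) (p : (Fin m → ℝ) × (Fin k → ℝ)) {x : ℝ → E n}
    {η : E n} {I : Set ℝ} {t : ℝ} (hx : HasDerivWithinAt x η I t) :
    HasDerivWithinAt (fun s => dualValue α F g (affineMap H c) p (x s))
      (α * ⟪constraintForce g (affineMap H c) (x t) p, η⟫ -
        ⟪controlSystem F g (affineMap H c) (x t) p,
          fderiv ℝ (fun y => controlSystem F g (affineMap H c) y p) (x t) η⟫) I t := by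
  have hweight := (hasGradientAt_weightedConstraint (fun i => hg i (x t))
    (fun j => differentiable_affineMap H c j (x t)) p).hasFDerivAt.comp_hasDerivWithinAt t hx
  have hsystem := (differentiable_controlSystem (H := H) (c := c) hF hg' p
    (x t)).hasFDerivAt.comp_hasDerivWithinAt t hx
  refine ((hweight.const_mul α).sub (hsystem.norm_sq.const_mul (1 / 2 : ℝ))).congr_deriv ?_
  rw [InnerProductSpace.toDual_apply_apply]
  simp only [Function.comp_apply]
  ring

theorem inner_controlSystem_add_weightedConstraint_le (hFm : IsStronglyMonotoneMap μ F)
    (hgc : ∀ i, ConvexOn ℝ univ (g i)) (hg : ∀ i, DifferentiableAt ℝ (g i) x)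
    (hxs : xs ∈ viSol F (constraintSet g (affineMap H c)))
    (hx : x ∈ constraintSet g (affineMap H c)) (hp : ∀ i, 0 ≤ p.1 i) :
    ⟪x - xs, controlSystem F g (affineMap H c) x p⟫ + weightedConstraint g (affineMap H c) p x ≤
      -(μ * ‖x - xs‖ ^ 2) := by
  have hmono := hFm x xs
  have hvi := hxs.2 x hx
  have hconvex := inner_constraintForce_sub_le (H := H) (c := c) hp hgc hg xs
  have hfeas := weightedConstraint_nonpos hp hxs.1
  rw [inner_sub_right] at hmono
  rw [← neg_sub x xs, inner_neg_right, real_inner_comm] at hconvex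
  rw [controlSystem, inner_sub_right, inner_neg_right]
  linarith

/-- Along a curve, the Lyapunov function is touched from above by the function obtained from it by
freezing the multipliers in the dual value. -/
theorem hasUpperSupport_lyapunovCandidate (hα : 0 < α) (hμ : 0 ≤ μ) (hF : Differentiable ℝ F)
    (hFm : IsStronglyMonotoneMap μ F) (hgc : ∀ i, ConvexOn ℝ univ (g i))
    (hg : ∀ i, Differentiable ℝ (g i)) (hg' : ∀ i, Differentiable ℝ (∇ (g i)))
    (hxs : xs ∈ viSol F (constraintSet g (affineMap H c))) {x : ℝ → E n} {I : Set ℝ} {t r : ℝ}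
    (hr : 0 ≤ r) (hxC : ∀ s ∈ I, x s ∈ constraintSet g (affineMap H c)) (ht : t ∈ I)
    (hp : IsKKT α F g (affineMap H c) (x t) p)
    (hx : HasDerivWithinAt x (r • controlSystem F g (affineMap H c) (x t) p) I t) :
    HasUpperSupport (fun s => lyapunovCandidate α F g (affineMap H c) xs (x s)) I t
      (-(r * (μ * ‖x t - xs‖ ^ 2))) := by
  refine ⟨fun s => 1 / 2 * ‖x s - xs‖ ^ 2 - 1 / α ^ 2 * dualValue α F g (affineMap H c) p (x s), _,
    fun s hs => ?_, ?_, ((hx.sub_const xs).norm_sq.const_mul (1 / 2 : ℝ)).sub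
      ((hasDerivWithinAt_dualValue hF hg hg' p hx).const_mul (1 / α ^ 2)), ?_⟩
  · simp only [lyapunovCandidate]
    gcongr
    exact dualValue_le_optimalValue hp.nonneg ⟨0, zero_mem_restrictedTangentSet hα.le (hxC s hs)⟩
  · simp only [lyapunovCandidate, hp.optimalValue_eq_dualValue]
  set ξ := controlSystem F g (affineMap H c) (x t) p
  set D := fderiv ℝ (fun y => controlSystem F g (affineMap H c) y p) (x t)
  have hcurv : 1 / α ^ 2 * ⟪ξ, D ξ⟫ ≤ 0 := mul_nonpos_of_nonneg_of_nonpos (by positivity) <|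
    (inner_fderiv_controlSystem_le hF hFm hgc hg hg' hp.nonneg (x t) ξ).trans
      (neg_nonpos.2 (by positivity))
  have hdist := inner_controlSystem_add_weightedConstraint_le hFm hgc (fun i => hg i (x t)) hxs
    (hxC t ht) hp.nonneg
  calc _ = r * (⟪x t - xs, ξ⟫ + weightedConstraint g (affineMap H c) p (x t)
          + 1 / α ^ 2 * ⟪ξ, D ξ⟫) := by
        rw [map_smul, inner_smul_right, inner_smul_right, inner_smul_right,
          hp.inner_constraintForce_eq]
        field_simp
        ring
    _ ≤ r * -(μ * ‖x t - xs‖ ^ 2) := by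
        gcongr
        linarith
    _ = _ := mul_neg _ _

end LyapunovFunction

/-! ### Lyapunov functions for set-valued flows -/

section Stability

variable {𝓖 : E n → Set (E n)} {C : Set (E n)} {xs : E n} {V w : E n → ℝ} {x : ℝ → E n}
  {I J : Set ℝ}

theorem IsSolutionOn.mono (hx : IsSolutionOn 𝓖 x J) (hIJ : I ⊆ J) : IsSolutionOn 𝓖 x I :=
  fun t ht => let ⟨ξ, hξ, hd⟩ := hx t (hIJ ht)
  ⟨ξ, hξ, hd.mono hIJ⟩

/-- `V` is a continuous function on `C` that dominates `½ ‖x - xs‖²`, vanishes at `xs`, and decays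
at rate at least `w` along the flow, in the sense of upper supports. The decay is required along
every curve in `C` whose velocity is a multiple `r • ξ`, `r ≥ 0`, of a velocity of the flow, so
that it is available for truncations of the flow as well. -/
structure IsLyapunovCertificate (𝓖 : E n → Set (E n)) (C : Set (E n)) (xs : E n)
    (V w : E n → ℝ) : Prop where
  continuousOn : ContinuousOn V C
  eq_zero : V xs = 0
  half_norm_sq_le : ∀ x ∈ C, 1 / 2 * ‖x - xs‖ ^ 2 ≤ V x
  rate_nonneg : ∀ x ∈ C, 0 ≤ w x
  hasUpperSupport : ∀ ⦃x : ℝ → E n⦄ ⦃I : Set ℝ⦄ ⦃t r : ℝ⦄ ⦃ξ : E n⦄, 0 ≤ r →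
    (∀ s ∈ I, x s ∈ C) → t ∈ I → ξ ∈ 𝓖 (x t) → HasDerivWithinAt x (r • ξ) I t →
    HasUpperSupport (fun s => V (x s)) I t (-(r * w (x t)))

namespace IsLyapunovCertificate

theorem le_sub_mul (hV : IsLyapunovCertificate 𝓖 C xs V w) {r : ℝ → ℝ} {a b d : ℝ} (hab : a ≤ b)
    (hr : ∀ t ∈ Icc a b, 0 ≤ r t) (hxC : ∀ t ∈ Icc a b, x t ∈ C)
    (hx : ∀ t ∈ Icc a b, ∃ ξ ∈ 𝓖 (x t), HasDerivWithinAt x (r t • ξ) (Icc a b) t)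
    (hd : ∀ t ∈ Icc a b, d ≤ r t * w (x t)) : V (x b) ≤ V (x a) - d * (b - a) := by
  have hxc : ContinuousOn x (Icc a b) := fun t ht =>
    let ⟨_, _, hder⟩ := hx t ht
    hder.continuousWithinAt
  rw [sub_eq_add_neg, ← neg_mul]
  refine le_add_mul_of_hasUpperSupport (φ := fun t => V (x t)) (hV.continuousOn.comp hxc hxC)
    (fun t ht => ?_) (right_mem_Icc.2 hab)
  have htI := Ico_subset_Icc_self ht
  obtain ⟨ξ, hξ, hder⟩ := hx t htI
  exact (hV.hasUpperSupport (hr t htI) hxC htI hξ hder).mono (neg_le_neg (hd t htI))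

theorem le_sub_mul_of_isSolutionOn (hV : IsLyapunovCertificate 𝓖 C xs V w) {a b d : ℝ}
    (hab : a ≤ b) (hx : IsSolutionOn 𝓖 x (Icc a b)) (hxC : ∀ t ∈ Icc a b, x t ∈ C)
    (hd : ∀ t ∈ Icc a b, d ≤ w (x t)) : V (x b) ≤ V (x a) - d * (b - a) :=
  hV.le_sub_mul (r := 1) hab (fun _ _ => zero_le_one) hxC (by simpa [IsSolutionOn] using hx)
    (by simpa using hd)

theorem half_norm_sq_le_of_isSolutionOn (hV : IsLyapunovCertificate 𝓖 C xs V w) {a b : ℝ}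
    (hab : a ≤ b) (hx : IsSolutionOn 𝓖 x (Icc a b)) (hxC : ∀ t ∈ Icc a b, x t ∈ C) :
    1 / 2 * ‖x b - xs‖ ^ 2 ≤ V (x a) := by
  have hdecr := hV.le_sub_mul_of_isSolutionOn hab hx hxC fun t ht => hV.rate_nonneg _ (hxC t ht)
  rw [zero_mul, sub_zero] at hdecr
  exact (hV.half_norm_sq_le _ (hxC b (right_mem_Icc.2 hab))).trans hdecr

theorem exists_forall_norm_lt (hV : IsLyapunovCertificate 𝓖 C xs V w) (hxs : xs ∈ C) {ε : ℝ}
    (hε : 0 < ε) : ∃ δ > 0, ∀ ⦃a b : ℝ⦄ ⦃x : ℝ → E n⦄, a ≤ b → IsSolutionOn 𝓖 x (Icc a b) →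
      (∀ t ∈ Icc a b, x t ∈ C) → ‖x a - xs‖ < δ → ‖x b - xs‖ < ε := by
  have hsmall := (hV.continuousOn xs hxs).eventually_lt_const (u := 1 / 2 * ε ^ 2)
    (by rw [hV.eq_zero]; positivity)
  obtain ⟨δ, hδ, hball⟩ := Metric.mem_nhdsWithin_iff.1 hsmall
  refine ⟨δ, hδ, fun a b x hab hx hxC hxa => lt_of_pow_lt_pow_left₀ 2 hε.le ?_⟩
  have hVa : V (x a) < 1 / 2 * ε ^ 2 :=
    hball ⟨mem_ball_iff_norm.2 hxa, hxC a (left_mem_Icc.2 hab)⟩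
  linarith [hV.half_norm_sq_le_of_isSolutionOn hab hx hxC]

theorem globallyLyapunovStableRel (hV : IsLyapunovCertificate 𝓖 C xs V w) (hC : IsClosed C)
    (hxs : xs ∈ C) (hex : ∀ x₀ ∈ C, ∃ x : ℝ → E n, x 0 = x₀ ∧ IsSolutionOn 𝓖 x (Ici 0))
    (hinv : ∀ (T : ℝ) (x : ℝ → E n), IsSolutionOn 𝓖 x (Icc 0 T) → x 0 ∈ C →
      ∀ t ∈ Icc 0 T, x t ∈ C) :
    GloballyLyapunovStableRel 𝓖 C xs where
  exists_solution := hex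
  invariant := hinv
  stable ε hε := by
    obtain ⟨δ, hδ, hnear⟩ := hV.exists_forall_norm_lt hxs hε
    refine ⟨δ, hδ, fun T x hx h0 hx0 t ht => ?_⟩
    have hsub : Icc 0 t ⊆ Icc 0 T := Icc_subset_Icc_right ht.2
    exact hnear ht.1 (hx.mono hsub) (fun s hs => hinv T x hx h0 s (hsub hs)) hx0
  bounded R := by
    obtain ⟨B, hB⟩ := ((isCompact_closedBall xs R).inter_left hC).bddAbove_image
      (hV.continuousOn.mono inter_subset_left)
    refine ⟨√(2 * B), fun T x hx h0 hx0 t ht => Real.le_sqrt_of_sq_le ?_⟩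
    have hsub : Icc 0 t ⊆ Icc 0 T := Icc_subset_Icc_right ht.2
    have hV0 := hB ⟨x 0, ⟨h0, mem_closedBall_iff_norm.2 hx0⟩, rfl⟩
    linarith [hV.half_norm_sq_le_of_isSolutionOn ht.1 (hx.mono hsub) fun s hs =>
      hinv T x hx h0 s (hsub hs)]

theorem isLyapunovFunctionOn (hV : IsLyapunovCertificate 𝓖 C xs V w)
    (hinv : ∀ (T : ℝ) (x : ℝ → E n), IsSolutionOn 𝓖 x (Icc 0 T) → x 0 ∈ C →
      ∀ t ∈ Icc 0 T, x t ∈ C) :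
    IsLyapunovFunctionOn 𝓖 C xs V w where
  continuousOn := hV.continuousOn
  eq_zero := hV.eq_zero
  pos x hx hne := by
    have : 0 < ‖x - xs‖ := norm_sub_pos_iff.2 hne
    exact lt_of_lt_of_le (by positivity) (hV.half_norm_sq_le x hx)
  dini_le T hT x hx h0 := by
    have h0T : (0 : ℝ) ∈ Icc 0 T := left_mem_Icc.2 hT.le
    obtain ⟨ξ, hξ, hder⟩ := hx 0 h0T
    have hsupp := hV.hasUpperSupport zero_le_one (hinv T x hx h0) h0T hξ (by rwa [one_smul])
    rw [one_mul] at hsupp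
    exact hsupp.upperRightDini_le (Icc_mem_nhdsGT hT)

theorem exists_norm_sub_lt (hV : IsLyapunovCertificate 𝓖 C xs V w) {μ : ℝ} (hμ : 0 < μ)
    (hw : ∀ x ∈ C, μ * ‖x - xs‖ ^ 2 ≤ w x) (hx : IsSolutionOn 𝓖 x (Ici 0))
    (hxC : ∀ t, 0 ≤ t → x t ∈ C) {δ : ℝ} (hδ : 0 < δ) : ∃ t, 0 ≤ t ∧ ‖x t - xs‖ < δ := by
  by_contra! hfar
  have hV₀ : 0 ≤ V (x 0) := le_trans (by positivity) (hV.half_norm_sq_le _ (hxC 0 le_rfl))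
  set T := (V (x 0) + 1) / (μ * δ ^ 2) with hT_def
  have hT : 0 ≤ T := by positivity
  have hdecr := hV.le_sub_mul_of_isSolutionOn (d := μ * δ ^ 2) hT (hx.mono Icc_subset_Ici_self)
    (fun t ht => hxC t ht.1) fun t ht => le_trans (by have := hfar t ht.1; gcongr)
      (hw _ (hxC t ht.1))
  rw [sub_zero, hT_def, mul_div_cancel₀ _ (by positivity)] at hdecr
  linarith [hV.half_norm_sq_le _ (hxC T hT), sq_nonneg ‖x T - xs‖]

theorem tendsto (hV : IsLyapunovCertificate 𝓖 C xs V w) (hxs : xs ∈ C) {μ : ℝ} (hμ : 0 < μ)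
    (hw : ∀ x ∈ C, μ * ‖x - xs‖ ^ 2 ≤ w x) (hx : IsSolutionOn 𝓖 x (Ici 0))
    (hxC : ∀ t, 0 ≤ t → x t ∈ C) : Tendsto x atTop (𝓝 xs) := by
  refine Metric.tendsto_atTop.2 fun ε hε => ?_
  obtain ⟨δ, hδ, hnear⟩ := hV.exists_forall_norm_lt hxs hε
  obtain ⟨t₀, ht₀, hxt₀⟩ := hV.exists_norm_sub_lt hμ hw hx hxC hδ
  refine ⟨t₀, fun t ht => ?_⟩
  rw [dist_eq_norm]
  exact hnear ht (hx.mono fun s hs => ht₀.trans hs.1) (fun s hs => hxC s (ht₀.trans hs.1)) hxt₀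

theorem globallyAsymptoticallyStableRel (hV : IsLyapunovCertificate 𝓖 C xs V w) {μ : ℝ}
    (hμ : 0 < μ) (hw : ∀ x ∈ C, μ * ‖x - xs‖ ^ 2 ≤ w x) (hxs : xs ∈ C)
    (hstable : GloballyLyapunovStableRel 𝓖 C xs) : GloballyAsymptoticallyStableRel 𝓖 C xs where
  toGloballyLyapunovStableRel := hstable
  attractive x hx h0 := hV.tendsto hxs hμ hw hx fun t ht =>
    hstable.invariant t x (hx.mono Icc_subset_Ici_self) h0 t (right_mem_Icc.2 ht)

/-- Truncating the velocity `v` far away from `xs` makes it bounded. A solution of the truncated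
equation never leaves the sublevel set of `V` through its initial point, where nothing has been
truncated. -/
theorem exists_isSolutionOn_Ici (hV : IsLyapunovCertificate 𝓖 C xs V w) (hC : IsClosed C)
    (hconv : Convex ℝ C) {v : E n → E n} (hv : ContinuousOn v C) (hv𝓖 : ∀ x ∈ C, v x ∈ 𝓖 x)
    (htan : ∀ u x, IsNearestPoint C u x → ⟪u - x, v x⟫ ≤ 0) {x₀ : E n} (hx₀ : x₀ ∈ C) :
    ∃ x : ℝ → E n, x 0 = x₀ ∧ IsSolutionOn 𝓖 x (Ici 0) := by
  set R := √(2 * V x₀)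
  have hR : 0 < R + 1 := add_pos_of_nonneg_of_pos (Real.sqrt_nonneg _) one_pos
  let χ : ContDiffBump xs := ⟨R + 1, R + 2, hR, by linarith⟩
  obtain ⟨x, hx0, hxC, hx⟩ := exists_forall_mem_hasDerivWithinAt_smul hC hconv hv htan χ.continuous
    χ.hasCompactSupport χ.nonneg' hx₀
  refine ⟨x, hx0, fun t ht => ⟨v (x t), hv𝓖 _ (hxC t ht), ?_⟩⟩
  have hdecr := hV.le_sub_mul (r := fun t => χ (x t)) (d := 0) ht (fun _ _ => χ.nonneg)
    (fun s hs => hxC s hs.1)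
    (fun s hs => ⟨v (x s), hv𝓖 _ (hxC s hs.1), (hx s hs.1).mono Icc_subset_Ici_self⟩)
    fun s hs => mul_nonneg χ.nonneg (hV.rate_nonneg _ (hxC s hs.1))
  rw [zero_mul, sub_zero, hx0] at hdecr
  have hxR : ‖x t - xs‖ ≤ R :=
    Real.le_sqrt_of_sq_le (by linarith [hV.half_norm_sq_le _ (hxC t ht)])
  have hχ : χ (x t) = 1 :=
    χ.one_of_mem_closedBall <| mem_closedBall_iff_norm.2 <|
      hxR.trans (le_add_of_nonneg_right zero_le_one)
  simpa [hχ] using hx t ht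

end IsLyapunovCertificate

end Stability

/-! ### Stability of the safe monotone flow -/

section SafeMonotoneFlow

variable {α μ : ℝ} {F : E n → E n} {g : Fin m → E n → ℝ} {h : Fin k → E n → ℝ}
  {H : Matrix (Fin k) (Fin n) ℝ} {c : Fin k → ℝ} {xs x₀ : E n}

theorem isStronglyMonotoneMap_zero_iff : IsStronglyMonotoneMap 0 F ↔ IsMonotoneMap F := by
  simp only [IsStronglyMonotoneMap, IsMonotoneMap, zero_mul]

theorem IsStronglyMonotoneMap.isMonotoneMap (hF : IsStronglyMonotoneMap μ F) (hμ : 0 ≤ μ) :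
    IsMonotoneMap F :=
  fun x y => (by positivity : 0 ≤ μ * ‖x - y‖ ^ 2).trans (hF x y)

theorem constraintSet_invariant (hg : ∀ i, Differentiable ℝ (g i))
    (hh : ∀ j, Differentiable ℝ (h j)) (T : ℝ) (x : ℝ → E n)
    (hx : IsSolutionOn (safeMonotoneFlow α F g h) x (Icc 0 T)) (h0 : x 0 ∈ constraintSet g h)
    (t : ℝ) (ht : t ∈ Icc 0 T) : x t ∈ constraintSet g h := by
  have hvel : ∀ t ∈ Icc 0 T, ∃ ξ ∈ restrictedTangentSet α g h (x t),
      HasDerivWithinAt x ξ (Icc 0 T) t := fun t ht =>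
    let ⟨_, ⟨_, hp, _, hξ⟩, hder⟩ := hx t ht
    ⟨_, hξ ▸ hp.2, hder⟩
  choose! ξ hξ hder using hvel
  have hcomp : ∀ {f : E n → ℝ}, Differentiable ℝ f → ∀ t ∈ Icc 0 T,
      HasDerivWithinAt (fun s => f (x s)) ⟪∇ f (x t), ξ t⟫ (Icc 0 T) t := fun hf t ht => by
    rw [inner_gradient_left]
    exact (hf (x t)).hasFDerivAt.comp_hasDerivWithinAt t (hder t ht)
  refine ⟨fun i => ?_, fun j => le_antisymm ?_ (neg_nonpos.1 ?_)⟩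
  · exact nonpos_of_hasDerivWithinAt_le_mul (hcomp (hg i)) (fun t ht => (hξ t ht).1 i) (h0.1 i) ht
  · exact nonpos_of_hasDerivWithinAt_le_mul (hcomp (hh j)) (fun t ht => ((hξ t ht).2 j).le)
      (h0.2 j).le ht
  · refine nonpos_of_hasDerivWithinAt_le_mul (φ := fun s => -h j (x s)) (K := -α)
      (fun t ht => (hcomp (hh j) t ht).fun_neg) (fun t ht => ?_) (by rw [h0.2 j, neg_zero]) ht
    rw [(hξ t ht).2 j, mul_neg]

theorem isLyapunovCertificate_lyapunovCandidate (hα : 0 < α) (hμ : 0 ≤ μ)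
    (hF : Differentiable ℝ F) (hFm : IsStronglyMonotoneMap μ F)
    (hgc : ∀ i, ConvexOn ℝ univ (g i)) (hg : ∀ i, Differentiable ℝ (g i))
    (hg' : ∀ i, Differentiable ℝ (∇ (g i))) (hS : SlaterCondition g (affineMap H c))
    (hxs : xs ∈ viSol F (constraintSet g (affineMap H c))) :
    IsLyapunovCertificate (safeMonotoneFlow α F g (affineMap H c))
      (constraintSet g (affineMap H c)) xs (lyapunovCandidate α F g (affineMap H c) xs)
      (fun x => μ * ‖x - xs‖ ^ 2) := by
  have hne := fun x => strictTangentSet_nonempty hα hgc (fun i => hg i x) hS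
  refine ⟨continuousOn_lyapunovCandidate hα hF.continuous hgc hg (fun i => (hg' i).continuous) hS
      xs,
    lyapunovCandidate_self hα.le (fun i => hg i xs) (hne xs) hxs, fun x hx => ?_,
    fun x _ => by positivity, fun x I t r ξ hr hxC ht hξ hx => ?_⟩
  · obtain ⟨p, hp⟩ := exists_isKKT F (hne x)
    exact half_norm_sq_le_lyapunovCandidate (hp.optimalValue_nonpos hα.le hx) xs
  · obtain ⟨p, hp⟩ := exists_isKKT F (hne (x t))
    rw [hp.safeMonotoneFlow_eq, mem_singleton_iff] at hξ
    exact hasUpperSupport_lyapunovCandidate hα hμ hF hFm hgc hg hg' hxs hr hxC ht hp (hξ ▸ hx)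

theorem exists_isSolutionOn_safeMonotoneFlow (hα : 0 < α)
    (hF : Differentiable ℝ F) (hFm : IsMonotoneMap F)
    (hgc : ∀ i, ConvexOn ℝ univ (g i)) (hg : ∀ i, Differentiable ℝ (g i))
    (hg' : ∀ i, Differentiable ℝ (∇ (g i))) (hS : SlaterCondition g (affineMap H c))
    (hxs : xs ∈ viSol F (constraintSet g (affineMap H c)))
    (hx₀ : x₀ ∈ constraintSet g (affineMap H c)) :
    ∃ x : ℝ → E n, x 0 = x₀ ∧ IsSolutionOn (safeMonotoneFlow α F g (affineMap H c)) x (Ici 0) := by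
  have hne := fun x => strictTangentSet_nonempty hα hgc (fun i => hg i x) hS
  choose p hp using fun x => exists_isKKT F (hne x)
  refine (isLyapunovCertificate_lyapunovCandidate hα le_rfl hF
    (isStronglyMonotoneMap_zero_iff.2 hFm) hgc hg hg' hS hxs).exists_isSolutionOn_Ici
    (v := fun x => controlSystem F g (affineMap H c) x (p x))
    (isClosed_constraintSet (fun i => (hg i).continuous)
      fun j => (differentiable_affineMap H c j).continuous)
    (convex_constraintSet hgc)
    (continuousOn_of_isNearestPoint_restrictedTangentSet hα hF.continuous hgc hg
      (fun i => (hg' i).continuous) hS fun x => (hp x).isNearestPoint)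
    (fun x _ => (hp x).safeMonotoneFlow_eq ▸ mem_singleton _)
    (fun u x hx => inner_nonpos_of_mem_restrictedTangentSet (fun i => hg i x) (hne x) hx (hp x).mem)
    hx₀

theorem globallyLyapunovStableRel_safeMonotoneFlow (hα : 0 < α)
    (hF : Differentiable ℝ F) (hFm : IsMonotoneMap F)
    (hgc : ∀ i, ConvexOn ℝ univ (g i)) (hg : ∀ i, Differentiable ℝ (g i))
    (hg' : ∀ i, Differentiable ℝ (∇ (g i))) (hS : SlaterCondition g (affineMap H c))
    (hxs : xs ∈ viSol F (constraintSet g (affineMap H c))) :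
    GloballyLyapunovStableRel (safeMonotoneFlow α F g (affineMap H c))
      (constraintSet g (affineMap H c)) xs :=
  (isLyapunovCertificate_lyapunovCandidate hα le_rfl hF (isStronglyMonotoneMap_zero_iff.2 hFm)
      hgc hg hg' hS hxs).globallyLyapunovStableRel
    (isClosed_constraintSet (fun i => (hg i).continuous)
      fun j => (differentiable_affineMap H c j).continuous)
    hxs.1
    (fun _ hx₀ => exists_isSolutionOn_safeMonotoneFlow hα hF hFm hgc hg hg' hS hxs hx₀)
    (constraintSet_invariant hg (differentiable_affineMap H c))

end SafeMonotoneFlow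

end SafeMonotoneFlow

end

open SafeMonotoneFlow in
theorem mainTheorem3_general {n m k : ℕ} {F : E n → E n} (hF : Differentiable ℝ F)
    {g : Fin m → E n → ℝ} (hg : ∀ i, Differentiable ℝ (g i))
    (hg' : ∀ i, Differentiable ℝ (∇ (g i))) (hgc : ∀ i, ConvexOn ℝ Set.univ (g i))
    {H : Matrix (Fin k) (Fin n) ℝ} {c : Fin k → ℝ} {α : ℝ} (hα : 0 < α)
    (hS : SlaterCondition g (affineMap H c)) {xs : E n}
    (hxs : xs ∈ viSol F (constraintSet g (affineMap H c))) :
    (IsMonotoneMap F →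
      GloballyLyapunovStableRel (safeMonotoneFlow α F g (affineMap H c))
        (constraintSet g (affineMap H c)) xs ∧
      IsLyapunovFunctionOn (safeMonotoneFlow α F g (affineMap H c))
        (constraintSet g (affineMap H c)) xs (lyapunovCandidate α F g (affineMap H c) xs)
        (fun _ => 0)) ∧
    (∀ μ : ℝ, 0 < μ → IsStronglyMonotoneMap μ F →
      GloballyAsymptoticallyStableRel (safeMonotoneFlow α F g (affineMap H c))
        (constraintSet g (affineMap H c)) xs ∧
      IsLyapunovFunctionOn (safeMonotoneFlow α F g (affineMap H c))
        (constraintSet g (affineMap H c)) xs (lyapunovCandidate α F g (affineMap H c) xs)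
        (fun x => μ * ‖x - xs‖ ^ 2)) := by
  have hinv := constraintSet_invariant (α := α) (F := F) hg (differentiable_affineMap H c)
  refine ⟨fun hFm => ?_, fun μ hμ hFm => ?_⟩
  · have hV := isLyapunovCertificate_lyapunovCandidate hα le_rfl hF
      (isStronglyMonotoneMap_zero_iff.2 hFm) hgc hg hg' hS hxs
    simp only [zero_mul] at hV
    exact ⟨globallyLyapunovStableRel_safeMonotoneFlow hα hF hFm hgc hg hg' hS hxs,
      hV.isLyapunovFunctionOn hinv⟩
  · have hV := isLyapunovCertificate_lyapunovCandidate hα hμ.le hF hFm hgc hg hg' hS hxs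
    have hstable := globallyLyapunovStableRel_safeMonotoneFlow hα hF (hFm.isMonotoneMap hμ.le)
      hgc hg hg' hS hxs
    exact ⟨hV.globallyAsymptoticallyStableRel hμ (fun _ _ => le_rfl) hxs.1 hstable,
      hV.isLyapunovFunctionOn hinv⟩

theorem mainTheorem3 {n m k : ℕ}
    (F : SafeMonotoneFlow.E n → SafeMonotoneFlow.E n) (hF : ContDiff ℝ 1 F)
    (g : Fin m → SafeMonotoneFlow.E n → ℝ) (hg : ∀ i, ContDiff ℝ 2 (g i))
    (hg_convex : ∀ i, ConvexOn ℝ Set.univ (g i))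
    (H : Matrix (Fin k) (Fin n) ℝ) (c : Fin k → ℝ)
    (α : ℝ) (hα : 0 < α)
    (hMFCQ : ∀ x ∈ SafeMonotoneFlow.constraintSet g (SafeMonotoneFlow.affineMap H c),
      SafeMonotoneFlow.MFCQAt g (SafeMonotoneFlow.affineMap H c) x)
    (xs : SafeMonotoneFlow.E n)
    (hxs : xs ∈ SafeMonotoneFlow.viSol F
      (SafeMonotoneFlow.constraintSet g (SafeMonotoneFlow.affineMap H c))) :
    (SafeMonotoneFlow.IsMonotoneMap F →
      SafeMonotoneFlow.GloballyLyapunovStableRel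
        (SafeMonotoneFlow.safeMonotoneFlow α F g (SafeMonotoneFlow.affineMap H c))
        (SafeMonotoneFlow.constraintSet g (SafeMonotoneFlow.affineMap H c)) xs ∧
      SafeMonotoneFlow.IsLyapunovFunctionOn
        (SafeMonotoneFlow.safeMonotoneFlow α F g (SafeMonotoneFlow.affineMap H c))
        (SafeMonotoneFlow.constraintSet g (SafeMonotoneFlow.affineMap H c)) xs
        (SafeMonotoneFlow.lyapunovCandidate α F g (SafeMonotoneFlow.affineMap H c) xs)
        (fun _ => 0)) ∧
    (∀ μ : ℝ, 0 < μ → SafeMonotoneFlow.IsStronglyMonotoneMap μ F →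
      SafeMonotoneFlow.GloballyAsymptoticallyStableRel
        (SafeMonotoneFlow.safeMonotoneFlow α F g (SafeMonotoneFlow.affineMap H c))
        (SafeMonotoneFlow.constraintSet g (SafeMonotoneFlow.affineMap H c)) xs ∧
      SafeMonotoneFlow.IsLyapunovFunctionOn
        (SafeMonotoneFlow.safeMonotoneFlow α F g (SafeMonotoneFlow.affineMap H c))
        (SafeMonotoneFlow.constraintSet g (SafeMonotoneFlow.affineMap H c)) xs
        (SafeMonotoneFlow.lyapunovCandidate α F g (SafeMonotoneFlow.affineMap H c) xs)
        (fun x => μ * ‖x - xs‖ ^ 2)) := by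
  exact mainTheorem3_general (hF.differentiable one_ne_zero)
    (fun i => (hg i).differentiable two_ne_zero)
    (fun i => (SafeMonotoneFlow.contDiff_gradient (hg i) one_add_one_eq_two.le).differentiable
      one_ne_zero)
    hg_convex hα
    (SafeMonotoneFlow.slaterCondition_of_mfcqAt
      (fun i => (hg i).differentiable two_ne_zero xs) hxs.1 (hMFCQ xs hxs.1))
    hxs
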